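/- Let $0<\eta<1$ and $\sigma>0$. Let $\theta_0,U_0\sim\mathcal N(0,1)$, $V_t\sim\mathcal N(0,1-\eta^2)$, $W_t\sim\mathcal N(0,\sigma^2)$ and $Z_t\sim\mathcal N(0,1)$ ($t\ge 1$) be independent. Consider the AR(1) process with noisy observations $$\theta_{t+1}=\eta\,\theta_t+V_{t+1},\qquad Y_{t+1}=\theta_t+W_{t+1},\qquad H_t=(Y_1,\dots,Y_t),$$ and, for a stepsize $\alpha\in(0,1)$ and a quantization noise intensity $\delta\ge 0$, the LMS agent $$U_{t+1}=U_t+\alpha\,(Y_{t+1}-U_t)+\delta Z_{t+1},\qquad U_t=U_t(\alpha,\delta).$$ Write $\mathbb I(\alpha,\delta)=\lim_{t\to\infty}\mathbb I(U_t;H_t)\in[0,\infty]$ for the steady-state information content of the agent state, and $$\mathcal E(\alpha,\delta)=\lim_{t\to\infty}\mathbb E\big[\mathbf d_{\rm KL}\big(\mathbb P(Y_{t+1}\in\cdot\mid H_t)\,\big\|\,\mathbb P(Y_{t+1}\in\cdot\mid U_t)\big)\big]$$ for the steady-state informational error. **Theorem.** The limits $\mathbb I(\alpha,\delta)$ and $\mathcal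 E(\alpha,\delta)$ exist for all $\alpha\in(0,1)$ and $\delta\ge 0$, and there is a stepsize $\alpha^*\in(0,1)$, depending only on $\eta$ and $\sigma$, such that: 1. (Finite capacity.) For every $C\in(0,\infty)$ and every $\alpha\in(0,1)$ there is exactly one $\delta_C(\alpha)>0$ with $\mathbb I(\alpha,\delta_C(\alpha))=C$, and $\alpha^*$ is the unique minimizer of $\alpha\mapsto\mathcal E(\alpha,\delta_C(\alpha))$ over $(0,1)$. Thus the optimal stepsize does not depend on $C$. 2. (No quantization noise.) $\mathbb I(\alpha,0)=\infty$ for all $\alpha\in(0,1)$; $\alpha^*$ is also the unique minimizer of $\alpha\mapsto\mathcal E(\alpha,0)$ over $(0,1)$, and $\mathcal E(\alpha^*,0)=0$. 3. (Markov property.) The noiseless agent with stepsize $\alpha^*$, in steady state, makes $Y_{t+1}\to U_t\to H_t$ Markov: if $\alpha=\alpha^*$, $\delta=0$ and $U_0$ is replaced by a random variable for which $(\theta_0,U_0)$ is jointly Gaussian and independent of the sequences $(V_t)$, $(W_t)$, and for which the process $((U_t,Y_t):t\ge 1)$ is stationary, then $Y_{t+1}$ and $H_t$ are conditionally independent given $U_t$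 for every $t\ge 0$. Such a $U_0$ exists. -/

import Mathlib

open MeasureTheory ProbabilityTheory Filter Topology Set
open scoped ENNReal NNReal

namespace LMS

/-- Labels of the primitive random variables that drive the environment and the agent:
the initial latent state `θ₀`, the initial agent state `U₀`, the process noise `V`,
the observation noise `W` and the standardized quantization noise `Z`
(so that the quantization noise of intensity `δ` is `δ Z`).
Of the three noise sequences only the terms with index `t ≥ 1` are used below. -/
inductive Source : Type
  | theta : Source
  | agent : Source
  | process (t : ℕ) : Source
  | observation (t : ℕ) : Source
  | quantization (t : ℕ) : Source

/-- `θ₀, U₀, Zₜ ~ N(0, 1)`, `Vₜ ~ N(0, 1 - η²)`, `Wₜ ~ N(0, σ²)`. -/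
noncomputable def Source.variance (η σ : ℝ) : Source → ℝ≥0
  | theta => 1
  | agent => 1
  | process _ => Real.toNNReal (1 - η ^ 2)
  | observation _ => Real.toNNReal (σ ^ 2)
  | quantization _ => 1

variable {Ω : Type*} [MeasurableSpace Ω]

/-- All primitive random variables are independent centred Gaussians with the prescribed
variances. -/
structure IsDriving (η σ : ℝ) (μ : Measure Ω) (ξ : Source → Ω → ℝ) : Prop where
  measurable : ∀ s, Measurable (ξ s)
  law : ∀ s, μ.map (ξ s) = gaussianReal 0 (s.variance η σ)
  indep : iIndepFun ξ μ

/-- The latent process: `θ_{t+1} = η θ_t + V_{t+1}`. -/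
def latent (η : ℝ) (ξ : Source → Ω → ℝ) : ℕ → Ω → ℝ
  | 0 => ξ .theta
  | t + 1 => fun ω => η * latent η ξ t ω + ξ (.process (t + 1)) ω

/-- The labels: `Y_{t+1} = θ_t + W_{t+1}`. There is no `Y_0`; the value `0` is a filler that
is never used. -/
def label (η : ℝ) (ξ : Source → Ω → ℝ) : ℕ → Ω → ℝ
  | 0 => 0
  | t + 1 => fun ω => latent η ξ t ω + ξ (.observation (t + 1)) ω

/-- The history `H_t = (Y_1, …, Y_t)`. -/
def history (η : ℝ) (ξ : Source → Ω → ℝ) (t : ℕ) (ω : Ω) : Fin t → ℝ :=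
  fun i => label η ξ (i + 1) ω

/-- The LMS recursion with stepsize `α` and quantization noise of intensity `δ`, started at `S₀`:
`U_{t+1} = U_t + α (Y_{t+1} - U_t) + δ Z_{t+1}`. -/
def stateFrom (η : ℝ) (ξ : Source → Ω → ℝ) (S₀ : Ω → ℝ) (α δ : ℝ) : ℕ → Ω → ℝ
  | 0 => S₀
  | t + 1 => fun ω =>
      stateFrom η ξ S₀ α δ t ω + α * (label η ξ (t + 1) ω - stateFrom η ξ S₀ α δ t ω)
        + δ * ξ (.quantization (t + 1)) ω

/-- The agent state `U_t`, with `U₀ ~ N(0, 1)` independent of everything else. -/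
def state (η : ℝ) (ξ : Source → Ω → ℝ) (α δ : ℝ) : ℕ → Ω → ℝ :=
  stateFrom η ξ (ξ .agent) α δ

/-- Mutual information `I(X; Z)` in nats: the divergence of the joint law from the product of the
marginal laws. -/
noncomputable def mutualInfo {E F : Type*} [MeasurableSpace E] [MeasurableSpace F]
    (μ : Measure Ω) (X : Ω → E) (Z : Ω → F) : ℝ≥0∞ :=
  InformationTheory.klDiv (μ.map fun ω => (X ω, Z ω)) ((μ.map X).prod (μ.map Z))

/-- The informational error `E[KL(P*_t ‖ P̃_t)]` at time `t`, with
`P*_t = P(Y_{t+1} ∈ · | H_t)` and `P̃_t = P(Y_{t+1} ∈ · | U_t)`. -/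
noncomputable def informationalError (η : ℝ) (μ : Measure Ω) [IsFiniteMeasure μ]
    (ξ : Source → Ω → ℝ) (α δ : ℝ) (t : ℕ) : ℝ≥0∞ :=
  ∫⁻ ω, InformationTheory.klDiv
      (condDistrib (label η ξ (t + 1)) (history η ξ t) μ (history η ξ t ω))
      (condDistrib (label η ξ (t + 1)) (state η ξ α δ t) μ (state η ξ α δ t ω)) ∂μ

/-- The information content `I(U_t; H_t)` of the agent state at time `t`. -/
noncomputable def informationContent (η : ℝ) (μ : Measure Ω)
    (ξ : Source → Ω → ℝ) (α δ : ℝ) (t : ℕ) : ℝ≥0∞ :=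
  mutualInfo μ (state η ξ α δ t) (history η ξ t)

/-- Steady-state informational error. -/
noncomputable def steadyError (η : ℝ) (μ : Measure Ω) [IsFiniteMeasure μ]
    (ξ : Source → Ω → ℝ) (α δ : ℝ) : ℝ≥0∞ :=
  limsup (fun t => informationalError η μ ξ α δ t) atTop

/-- Steady-state information content. -/
noncomputable def steadyContent (η : ℝ) (μ : Measure Ω)
    (ξ : Source → Ω → ℝ) (α δ : ℝ) : ℝ≥0∞ :=
  limsup (fun t => informationContent η μ ξ α δ t) atTop

/-- `S₀` is a steady-state initialization of the noiseless agent with stepsize `α`: `(θ₀, S₀)` is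
jointly Gaussian, independent of the process and observation noise, and with `U_0 = S₀` the process
`((U_t, Y_t) : t ≥ 1)` is stationary. -/
structure IsSteadyStart (η : ℝ) (μ : Measure Ω) (ξ : Source → Ω → ℝ) (α : ℝ) (S₀ : Ω → ℝ) :
    Prop where
  measurable : Measurable S₀
  gaussian : HasGaussianLaw (fun ω => (ξ .theta ω, S₀ ω)) μ
  indep : IndepFun (fun ω => (ξ .theta ω, S₀ ω))
    (fun ω (t : ℕ) => (ξ (.process t) ω, ξ (.observation t) ω)) μ
  stationary : IdentDistrib
    (fun ω (t : ℕ) => (stateFrom η ξ S₀ α 0 (t + 2) ω, label η ξ (t + 2) ω))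
    (fun ω (t : ℕ) => (stateFrom η ξ S₀ α 0 (t + 1) ω, label η ξ (t + 1) ω)) μ μ

/-- `X → U → Z` is Markov: `X` and `Z` are conditionally independent given `U`
(stated through conditional probabilities, so that `Ω` need not be standard Borel). -/
def IsMarkovTriple {E F G : Type*} [MeasurableSpace E] [mF : MeasurableSpace F]
    [MeasurableSpace G] (μ : Measure Ω) (X : Ω → E) (U : Ω → F) (Z : Ω → G) : Prop :=
  ∀ (A : Set E) (B : Set G), MeasurableSet A → MeasurableSet B →
    μ⟦X ⁻¹' A ∩ Z ⁻¹' B | mF.comap U⟧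
      =ᵐ[μ] μ⟦X ⁻¹' A | mF.comap U⟧ * μ⟦Z ⁻¹' B | mF.comap U⟧

end LMS

open LMS

/-!
All random variables are linear in independent centred Gaussian sources, so every quantity is a
function of second moments. A random variable is represented by a formal linear combination of the
sources (`Source →₀ ℝ`), on which the covariance is the bilinear form `covForm`; jointly Gaussian
variables are independent as soon as this form vanishes.

*Finite times.* The part of `U_t` that does not come from the labels is independent of `H_t`, so
`I(U_t; H_t) = log (Var U_t / Var(U_t | H_t)) / 2` (`informationContent_eq`). The Kalman filter
computes `E[θ_t | H_t]` and its error variance `P_t` (`covForm_kalman_error`); since the regression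
of `Y_{t+1}` on `U_t` and the one on `H_t` differ by a vector orthogonal to the Kalman innovation,
the informational error is `log (Var(Y_{t+1} | U_t) / Var(Y_{t+1} | H_t)) / 2`
(`informationalError_eq`). All these variances obey affine recursions, except `P_t`, which obeys the
Riccati recursion; the latter is a contraction towards a fixed point `p`.

*Optimization.* Let `c` and `v` be the steady-state covariance with `θ_t` and variance of the
noiseless agent. Quantization noise only adds to `v`, and fixing the content to `C` multiplies the
ratio `ρ = c² / v` by `1 - exp (-2 C)`, whatever the stepsize. The steady-state error is a strictly
decreasing function of `ρ`, so for every capacity one has to maximize `ρ`. The difference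
`1 - p - ρ` is a positive multiple of `(1 - α - η σ² / (p + σ²))²`
(`one_sub_sub_steadyCov_sq_div`): the only maximizer is `α* = 1 - η σ² / (p + σ²)`, for which
`ρ = 1 - p` and the noiseless error vanishes.

*Markov property.* In any steady state `(c, v)` are the second moments of the initialization,
because the covariance recursions have a unique fixed point. With stepsize `α*`, the multiple
`(c / v) U_t` follows the steady-state Kalman recursion, so `Y_{t+1} - (c / v) U_t` is uncorrelated
with `U_t` and `H_t`, hence independent of the pair (`covForm_steady_error`). A steady start exists because a
Gaussian start with moments `(c, v)` leaves the joint covariances of the sources unchanged when the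
dynamics is restarted at time `1`, and the law of a centred Gaussian process is determined by its
covariances.
-/

namespace LMS

/-! ### Gaussian laws: divergence, regression, conditional independence -/

section

variable {Ω : Type*} [MeasurableSpace Ω]

/-- If `μ` has the density `exp g` with respect to `ν`, then `KL(μ ‖ ν)` is the mean of `g`. -/
theorem klDiv_withDensity_exp {E : Type*} [MeasurableSpace E] {μ ν : Measure E}
    [IsProbabilityMeasure μ] [IsProbabilityMeasure ν] {g : E → ℝ} (hg : Measurable g)
    (hμ : μ = ν.withDensity fun x => ENNReal.ofReal (Real.exp (g x))) (hint : Integrable g μ) :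
    InformationTheory.klDiv μ ν = ENNReal.ofReal (∫ x, g x ∂μ) := by
  have hac : μ ≪ ν := hμ ▸ withDensity_absolutelyContinuous _ _
  have hllr : llr μ ν =ᵐ[μ] g := by
    have h := Measure.rnDeriv_withDensity ν (f := fun x => ENNReal.ofReal (Real.exp (g x)))
      (by fun_prop)
    rw [← hμ] at h
    filter_upwards [hac.ae_le h] with x hx
    simp [llr, hx, ENNReal.toReal_ofReal (Real.exp_pos _).le]
  rw [InformationTheory.klDiv_of_ac_of_integrable hac ((integrable_congr hllr).2 hint),
    integral_congr_ae hllr]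
  simp

/-- The log-likelihood ratio of `N(m, s)` against `N(n, r)`. -/
noncomputable def gaussianLLR (m n s r x : ℝ) : ℝ :=
  Real.log (r / s) / 2 - (x - m) ^ 2 / (2 * s) + (x - n) ^ 2 / (2 * r)

theorem gaussianPDF_mul_exp_gaussianLLR (m n x : ℝ) {s r : ℝ≥0} (hs : s ≠ 0) (hr : r ≠ 0) :
    gaussianPDF n r x * ENNReal.ofReal (Real.exp (gaussianLLR m n s r x)) = gaussianPDF m s x := by
  have hs' : (0 : ℝ) < s := by positivity
  have hr' : (0 : ℝ) < r := by positivity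
  rw [gaussianPDF, gaussianPDF, ← ENNReal.ofReal_mul (gaussianPDFReal_nonneg _ _ _)]
  congr 1
  have hlog : Real.exp (Real.log (r / s) / 2) = √r / √s := by
    rw [← Real.log_sqrt (by positivity), Real.exp_log (by positivity), Real.sqrt_div hr'.le]
  have h1 : √(2 * Real.pi * r) = √(2 * Real.pi) * √r := Real.sqrt_mul (by positivity) _
  have h2 : √(2 * Real.pi * s) = √(2 * Real.pi) * √s := Real.sqrt_mul (by positivity) _
  have h3 : √(r : ℝ) ≠ 0 := by positivity
  have h4 : -(x - n) ^ 2 / (2 * (r : ℝ)) + gaussianLLR m n s r x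
      = Real.log (r / s) / 2 + -(x - m) ^ 2 / (2 * s) := by
    rw [gaussianLLR]; ring
  rw [gaussianPDFReal, gaussianPDFReal, mul_assoc, ← Real.exp_add, h4, Real.exp_add, hlog, h1, h2]
  field_simp

theorem gaussianReal_eq_withDensity (m n : ℝ) {s r : ℝ≥0} (hs : s ≠ 0) (hr : r ≠ 0) :
    gaussianReal m s = (gaussianReal n r).withDensity
      fun x => ENNReal.ofReal (Real.exp (gaussianLLR m n s r x)) := by
  have hm : Measurable fun x => ENNReal.ofReal (Real.exp (gaussianLLR m n s r x)) := by
    unfold gaussianLLR; fun_prop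
  rw [gaussianReal_of_var_ne_zero _ hs, gaussianReal_of_var_ne_zero _ hr,
    ← withDensity_mul _ (measurable_gaussianPDF _ _) hm]
  congr 1
  ext x
  exact (gaussianPDF_mul_exp_gaussianLLR m n x hs hr).symm

theorem integral_sub_sq_gaussianReal (m n : ℝ) (s : ℝ≥0) :
    Integrable (fun x => (x - n) ^ 2) (gaussianReal m s) ∧
      ∫ x, (x - n) ^ 2 ∂gaussianReal m s = s + (m - n) ^ 2 := by
  have h2 : MemLp (fun x : ℝ => x) 2 (gaussianReal m s) := memLp_id_gaussianReal 2
  have hi : Integrable (fun x : ℝ => x ^ 2) (gaussianReal m s) := h2.integrable_sq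
  have h1 : Integrable (fun x : ℝ => x) (gaussianReal m s) := h2.integrable one_le_two
  have hv := variance_eq_sub h2
  rw [variance_fun_id_gaussianReal, integral_id_gaussianReal] at hv
  have hfun : (fun x : ℝ => (x - n) ^ 2) = fun x => x ^ 2 - 2 * n * x + n ^ 2 := by ext; ring
  have hI : ∫ x, x ^ 2 ∂gaussianReal m s = s + m ^ 2 := by
    simp only [Pi.pow_apply] at hv
    linarith
  have h3 : Integrable (fun x : ℝ => 2 * n * x) (gaussianReal m s) := h1.const_mul _
  have h4 : Integrable (fun x : ℝ => x ^ 2 - 2 * n * x) (gaussianReal m s) := hi.sub h3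
  rw [hfun]
  refine ⟨h4.add (integrable_const _), ?_⟩
  rw [integral_add h4 (integrable_const _), integral_sub hi h3, hI, integral_const_mul,
    integral_id_gaussianReal]
  simp; ring

/-- The divergence of two nondegenerate real Gaussians. -/
theorem klDiv_gaussianReal (m n : ℝ) {s r : ℝ≥0} (hs : s ≠ 0) (hr : r ≠ 0) :
    InformationTheory.klDiv (gaussianReal m s) (gaussianReal n r)
      = ENNReal.ofReal (Real.log (r / s) / 2 - 1 / 2 + (s + (m - n) ^ 2) / (2 * r)) := by
  obtain ⟨i1, e1⟩ := integral_sub_sq_gaussianReal m m s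
  obtain ⟨i2, e2⟩ := integral_sub_sq_gaussianReal m n s
  have hs' : (s : ℝ) ≠ 0 := by simpa using hs
  have hA : Integrable (fun x => Real.log (r / s) / 2 - (x - m) ^ 2 / (2 * s))
      (gaussianReal m s) := (integrable_const _).sub (i1.div_const _)
  rw [klDiv_withDensity_exp (by unfold gaussianLLR; fun_prop)
    (gaussianReal_eq_withDensity m n hs hr)]
  · simp only [gaussianLLR]
    rw [integral_add hA (i2.div_const _), integral_sub (integrable_const _) (i1.div_const _),
      integral_div _ (fun x => (x - m) ^ 2), integral_div _ (fun x => (x - n) ^ 2), e1, e2]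
    congr 2
    simp; field_simp
  · exact hA.add (i2.div_const _)

/-- Nonnegativity of the Gaussian divergence as a real number, needed because `ENNReal.ofReal`
truncates. -/
theorem klDiv_gaussianReal_nonneg (d : ℝ) {s r : ℝ} (hs : 0 < s) (hr : 0 < r) :
    0 ≤ Real.log (r / s) / 2 - 1 / 2 + (s + d ^ 2) / (2 * r) := by
  have h := Real.log_le_sub_one_of_pos (div_pos hs hr)
  have h2 : Real.log (r / s) = - Real.log (s / r) := by rw [← Real.log_inv, inv_div]
  have h3 : (s + d ^ 2) / (2 * r) = s / r / 2 + d ^ 2 / (2 * r) := by field_simp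
  have : 0 ≤ d ^ 2 / (2 * r) := by positivity
  rw [h2, h3]; linarith

/-- The kernel `x ↦ N(f x, s)`. -/
noncomputable def gaussianKernel {F : Type*} [MeasurableSpace F] (f : F → ℝ) (hf : Measurable f)
    (s : ℝ≥0) : Kernel F ℝ where
  toFun x := gaussianReal (f x) s
  measurable' := measurable_gaussianReal.comp (hf.prodMk measurable_const)

instance {F : Type*} [MeasurableSpace F] (f : F → ℝ) (hf : Measurable f) (s : ℝ≥0) :
    IsMarkovKernel (gaussianKernel f hf s) :=
  ⟨fun x => inferInstanceAs (IsProbabilityMeasure (gaussianReal (f x) s))⟩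

/-- If `Y = f X + ε` with `ε ~ N(0, s)` independent of `X`, the joint law of `(X, Y)` disintegrates
along the kernel `x ↦ N(f x, s)`. -/
theorem map_prodMk_eq_compProd_gaussianKernel {F : Type*} [MeasurableSpace F] {μ : Measure Ω}
    [IsProbabilityMeasure μ] {X : Ω → F} {Y : Ω → ℝ} {f : F → ℝ} (hX : Measurable X)
    (hY : Measurable Y) (hf : Measurable f) {s : ℝ≥0}
    (hind : IndepFun X (fun ω => Y ω - f (X ω)) μ)
    (hlaw : μ.map (fun ω => Y ω - f (X ω)) = gaussianReal 0 s) :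
    μ.map (fun ω => (X ω, Y ω)) = μ.map X ⊗ₘ gaussianKernel f hf s := by
  have hε : Measurable fun ω => Y ω - f (X ω) := by fun_prop
  have hj := (indepFun_iff_map_prod_eq_prod_map_map hX.aemeasurable hε.aemeasurable).1 hind
  have hT : Measurable fun p : F × ℝ => (p.1, p.2 + f p.1) := by fun_prop
  have hXY : (fun ω => (X ω, Y ω))
      = (fun p : F × ℝ => (p.1, p.2 + f p.1)) ∘ fun ω => (X ω, Y ω - f (X ω)) := by
    ext ω <;> simp
  have := Measure.isProbabilityMeasure_map hX.aemeasurable (μ := μ)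
  rw [hXY, ← Measure.map_map hT (hX.prodMk hε), hj, hlaw]
  ext A hA
  rw [Measure.map_apply hT hA, Measure.prod_apply (hT hA), Measure.compProd_apply hA]
  refine lintegral_congr fun x => ?_
  change _ = gaussianReal (f x) s (Prod.mk x ⁻¹' A)
  rw [← zero_add (f x), ← gaussianReal_map_add_const, Measure.map_apply (by fun_prop)
    (measurable_prodMk_left hA)]
  simp [preimage_preimage]

/-- Gaussian regression: `N(f X, s)` is the conditional law of `Y` given `X` when the residual
`Y - f X` has law `N(0, s)` and is independent of `X`. -/
theorem condDistrib_eq_gaussianKernel {F : Type*} [MeasurableSpace F] {μ : Measure Ω}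
    [IsProbabilityMeasure μ] {X : Ω → F} {Y : Ω → ℝ} {f : F → ℝ} (hX : Measurable X)
    (hY : Measurable Y) (hf : Measurable f) {s : ℝ≥0}
    (hind : IndepFun X (fun ω => Y ω - f (X ω)) μ)
    (hlaw : μ.map (fun ω => Y ω - f (X ω)) = gaussianReal 0 s) :
    condDistrib Y X μ =ᵐ[μ.map X] gaussianKernel f hf s :=
  condDistrib_ae_eq_of_measure_eq_compProd_of_measurable hX hY
    (map_prodMk_eq_compProd_gaussianKernel hX hY hf hind hlaw)

theorem integral_sq_of_map_eq_gaussianReal {μ : Measure Ω} {X : Ω → ℝ} {s : ℝ≥0}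
    (hX : Measurable X) (hlaw : μ.map X = gaussianReal 0 s) :
    Integrable (fun ω => X ω ^ 2) μ ∧ ∫ ω, X ω ^ 2 ∂μ = s := by
  obtain ⟨i, e⟩ := integral_sub_sq_gaussianReal 0 0 s
  simp only [sub_zero] at i e
  rw [← hlaw] at i e
  refine ⟨i.comp_measurable hX, ?_⟩
  rw [integral_map hX.aemeasurable (by fun_prop)] at e
  simpa using e

/-- If `U = f H + ε ~ N(0, v)` with `ε ~ N(0, q)` independent of `H`, then
`I(U; H) = log (v / q) / 2`. -/
theorem mutualInfo_eq_of_gaussian_regression {F : Type*} [MeasurableSpace F] {μ : Measure Ω}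
    [IsProbabilityMeasure μ] {H : Ω → F} {U : Ω → ℝ} {f : F → ℝ} (hH : Measurable H)
    (hU : Measurable U) (hf : Measurable f) {q v : ℝ≥0} (hq : q ≠ 0) (hv : v ≠ 0)
    (hind : IndepFun H (fun ω => U ω - f (H ω)) μ)
    (hlaw : μ.map (fun ω => U ω - f (H ω)) = gaussianReal 0 q)
    (hlawU : μ.map U = gaussianReal 0 v) :
    mutualInfo μ U H = ENNReal.ofReal (Real.log (v / q) / 2) := by
  have := Measure.isProbabilityMeasure_map hH.aemeasurable (μ := μ)
  have := Measure.isProbabilityMeasure_map hU.aemeasurable (μ := μ)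
  have := Measure.isProbabilityMeasure_map (hU.prodMk hH).aemeasurable (μ := μ)
  have hg : Measurable fun p : ℝ × F => gaussianLLR (f p.2) 0 q v p.1 := by
    unfold gaussianLLR; fun_prop
  have hg' : Measurable fun p : ℝ × F =>
      ENNReal.ofReal (Real.exp (gaussianLLR (f p.2) 0 q v p.1)) := by fun_prop
  have hdens : μ.map (fun ω => (U ω, H ω)) = ((μ.map U).prod (μ.map H)).withDensity
      fun p => ENNReal.ofReal (Real.exp (gaussianLLR (f p.2) 0 q v p.1)) := by
    have hswap : (fun ω => (U ω, H ω)) = Prod.swap ∘ fun ω => (H ω, U ω) := rfl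
    ext A hA
    rw [hswap, ← Measure.map_map measurable_swap (hH.prodMk hU),
      map_prodMk_eq_compProd_gaussianKernel hH hU hf hind hlaw,
      Measure.map_apply measurable_swap hA, Measure.compProd_apply (measurable_swap hA),
      withDensity_apply _ hA, ← lintegral_indicator hA,
      lintegral_prod_symm _ (hg'.indicator hA).aemeasurable]
    refine lintegral_congr fun h => ?_
    have hAh : MeasurableSet {u : ℝ | (u, h) ∈ A} := measurable_prodMk_right hA
    change gaussianReal (f h) q {u : ℝ | (u, h) ∈ A} = _
    rw [gaussianReal_eq_withDensity (f h) 0 hq hv, withDensity_apply _ hAh, hlawU,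
      ← lintegral_indicator hAh]
    rfl
  obtain ⟨i1, e1⟩ := integral_sq_of_map_eq_gaussianReal (by fun_prop) hlaw
  obtain ⟨i2, e2⟩ := integral_sq_of_map_eq_gaussianReal hU hlawU
  have hA : Integrable (fun ω => Real.log (v / q) / 2 - (U ω - f (H ω)) ^ 2 / (2 * q)) μ :=
    (integrable_const _).sub (i1.div_const _)
  have hint : Integrable (fun ω => gaussianLLR (f (H ω)) 0 q v (U ω)) μ := by
    simpa [gaussianLLR] using! hA.add (i2.div_const _)
  rw [mutualInfo, klDiv_withDensity_exp hg hdens]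
  · rw [integral_map (hU.prodMk hH).aemeasurable hg.aestronglyMeasurable]
    simp only [gaussianLLR, sub_zero]
    rw [integral_add hA (i2.div_const _), integral_sub (integrable_const _) (i1.div_const _),
      integral_div _ (fun ω => (U ω - f (H ω)) ^ 2), integral_div _ (fun ω => U ω ^ 2), e1, e2]
    have hq' : (q : ℝ) ≠ 0 := by simpa using hq
    have hv' : (v : ℝ) ≠ 0 := by simpa using hv
    congr 1
    simp; field_simp; ring
  · exact (integrable_map_measure hg.aestronglyMeasurable (hU.prodMk hH).aemeasurable).2 hint

/-- If `N(f H, s)` and `N(g U, r)` are the conditional laws of `Y` given `H` and given `U`, and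
the two regressions differ by `r - s` in mean square, then the expected divergence of the two
conditional laws is `log (r / s) / 2`. -/
theorem lintegral_klDiv_condDistrib {F G : Type*} [MeasurableSpace F] [MeasurableSpace G]
    {μ : Measure Ω} [IsProbabilityMeasure μ] {H : Ω → F} {U : Ω → G} {Y : Ω → ℝ} {f : F → ℝ}
    {g : G → ℝ} (hH : Measurable H) (hU : Measurable U) (hY : Measurable Y) (hf : Measurable f)
    (hg : Measurable g) {s r : ℝ≥0} (hs : s ≠ 0) (hr : r ≠ 0)
    (hindH : IndepFun H (fun ω => Y ω - f (H ω)) μ)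
    (hlawH : μ.map (fun ω => Y ω - f (H ω)) = gaussianReal 0 s)
    (hindU : IndepFun U (fun ω => Y ω - g (U ω)) μ)
    (hlawU : μ.map (fun ω => Y ω - g (U ω)) = gaussianReal 0 r)
    (hint : Integrable (fun ω => (f (H ω) - g (U ω)) ^ 2) μ)
    (hsq : ∫ ω, (f (H ω) - g (U ω)) ^ 2 ∂μ = r - s) :
    ∫⁻ ω, InformationTheory.klDiv (condDistrib Y H μ (H ω)) (condDistrib Y U μ (U ω)) ∂μ
      = ENNReal.ofReal (Real.log (r / s) / 2) := by
  have h1 := ae_of_ae_map hH.aemeasurable (condDistrib_eq_gaussianKernel hH hY hf hindH hlawH)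
  have h2 := ae_of_ae_map hU.aemeasurable (condDistrib_eq_gaussianKernel hU hY hg hindU hlawU)
  have hs' : (0 : ℝ) < s := by positivity
  have hr' : (0 : ℝ) < r := by positivity
  have i1 : Integrable (fun ω => (s + (f (H ω) - g (U ω)) ^ 2) / (2 * (r : ℝ))) μ :=
    ((integrable_const _).add hint).div_const _
  have i2 : Integrable (fun ω => Real.log (r / s) / 2 - 1 / 2
      + (s + (f (H ω) - g (U ω)) ^ 2) / (2 * (r : ℝ))) μ := (integrable_const _).add i1
  calc _ = ∫⁻ ω, ENNReal.ofReal (Real.log (r / s) / 2 - 1 / 2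
        + (s + (f (H ω) - g (U ω)) ^ 2) / (2 * r)) ∂μ := by
        refine lintegral_congr_ae ?_
        filter_upwards [h1, h2] with ω e1 e2
        rw [e1, e2]
        exact klDiv_gaussianReal _ _ hs hr
    _ = _ := by
        rw [← ofReal_integral_eq_lintegral_ofReal i2
          (Eventually.of_forall fun ω => klDiv_gaussianReal_nonneg _ hs' hr'),
          integral_add (integrable_const _) i1,
          integral_div _ (fun ω => s + (f (H ω) - g (U ω)) ^ 2),
          integral_add (integrable_const _) hint, hsq]
        congr 1
        simp; field_simp; ring

/-- If `Y = f U + ε` with `ε` independent of the pair `(U, H)`, then `Y` and `H` are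
conditionally independent given `U`: conditionally on `(U, H)`, the law of `Y` depends on `U`
only. -/
theorem isMarkovTriple_of_gaussian_regression {F G : Type*} [MeasurableSpace F]
    [MeasurableSpace G] {μ : Measure Ω} [IsProbabilityMeasure μ] {U : Ω → F} {H : Ω → G}
    {Y : Ω → ℝ} {f : F → ℝ} (hU : Measurable U) (hH : Measurable H) (hY : Measurable Y)
    (hf : Measurable f) {s : ℝ≥0}
    (hind : IndepFun (fun ω => (U ω, H ω)) (fun ω => Y ω - f (U ω)) μ)
    (hlaw : μ.map (fun ω => Y ω - f (U ω)) = gaussianReal 0 s) :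
    IsMarkovTriple μ Y U H := by
  intro A B hA hB
  have hUH : Measurable fun ω => (U ω, H ω) := hU.prodMk hH
  have hf2 : Measurable fun p : F × G => f p.1 := by fun_prop
  have key := ae_of_ae_map hUH.aemeasurable
    (condDistrib_eq_gaussianKernel hUH hY hf2 hind hlaw)
  have hindU : IndepFun U (fun ω => Y ω - f (U ω)) μ := hind.comp measurable_fst measurable_id
  have keyU := ae_of_ae_map hU.aemeasurable (condDistrib_eq_gaussianKernel hU hY hf hindU hlaw)
  set m₁ : MeasurableSpace Ω := MeasurableSpace.comap U inferInstance with hm₁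
  set m₂ : MeasurableSpace Ω := MeasurableSpace.comap (fun ω => (U ω, H ω)) inferInstance with hm₂
  have h₁₂ : m₁ ≤ m₂ :=
    (measurable_fst.comp (comap_measurable fun ω => (U ω, H ω))).comap_le
  -- `φ` is the conditional probability of `Y ∈ A` both given `U` and given `(U, H)`.
  set φ : Ω → ℝ := fun ω => (gaussianReal (f (U ω)) s).real A with hφ
  have hφm : StronglyMeasurable[m₁] φ :=
    (((Measure.measurable_coe hA).comp (gaussianKernel f hf s).measurable).ennreal_toReal.comp
      (comap_measurable U)).stronglyMeasurable
  have e1 : μ⟦Y ⁻¹' A | m₁⟧ =ᵐ[μ] φ := by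
    refine (condDistrib_ae_eq_condExp hU hY hA).symm.trans ?_
    filter_upwards [keyU] with ω h
    rw [h]; rfl
  have e2 : μ⟦Y ⁻¹' A | m₂⟧ =ᵐ[μ] φ := by
    refine (condDistrib_ae_eq_condExp hUH hY hA).symm.trans ?_
    filter_upwards [key] with ω h
    rw [h]; rfl
  have hbm : MeasurableSet[m₂] (H ⁻¹' B) :=
    (measurable_snd.comp (comap_measurable fun ω => (U ω, H ω))) hB
  have hAB : (Y ⁻¹' A ∩ H ⁻¹' B).indicator (fun _ => (1 : ℝ))
      = (H ⁻¹' B).indicator (fun _ => (1 : ℝ)) * (Y ⁻¹' A).indicator fun _ => (1 : ℝ) := by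
    rw [inter_comm]
    ext ω
    by_cases h : ω ∈ H ⁻¹' B <;> by_cases h' : ω ∈ Y ⁻¹' A <;> simp_all
  have ia : Integrable ((Y ⁻¹' A).indicator fun _ => (1 : ℝ)) μ :=
    (integrable_const _).indicator (hY hA)
  have ib : Integrable ((H ⁻¹' B).indicator fun _ => (1 : ℝ)) μ :=
    (integrable_const _).indicator (hH hB)
  have e3 : μ⟦Y ⁻¹' A ∩ H ⁻¹' B | m₂⟧ =ᵐ[μ] (H ⁻¹' B).indicator (fun _ => (1 : ℝ)) * φ := by
    rw [hAB]
    refine (condExp_stronglyMeasurable_mul_of_bound hUH.comap_le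
      (stronglyMeasurable_const.indicator hbm) ia 1 (Eventually.of_forall fun ω => ?_)).trans
      (EventuallyEq.rfl.mul e2)
    by_cases h : ω ∈ H ⁻¹' B <;> simp [h]
  have e4 : μ⟦Y ⁻¹' A ∩ H ⁻¹' B | m₁⟧ =ᵐ[μ] φ * μ⟦H ⁻¹' B | m₁⟧ := by
    refine (condExp_condExp_of_le h₁₂ hUH.comap_le).symm.trans ?_
    refine (condExp_congr_ae e3).trans ?_
    rw [mul_comm]
    refine condExp_stronglyMeasurable_mul_of_bound hU.comap_le hφm ib 1
      (Eventually.of_forall fun ω => ?_)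
    rw [Real.norm_of_nonneg measureReal_nonneg]
    exact measureReal_le_one
  exact e4.trans (e1.symm.mul EventuallyEq.rfl)

/-- The law of a centred real Gaussian process is determined by its covariance function. -/
theorem map_eq_of_isGaussianProcess {T : Type*} {μ : Measure Ω} [IsProbabilityMeasure μ]
    {X Y : T → Ω → ℝ} (hX : IsGaussianProcess X μ) (hY : IsGaussianProcess Y μ)
    (hXm : ∀ t, Measurable (X t)) (hYm : ∀ t, Measurable (Y t))
    (hX0 : ∀ t, ∫ ω, X t ω ∂μ = 0) (hY0 : ∀ t, ∫ ω, Y t ω ∂μ = 0)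
    (hcov : ∀ s t, cov[X s, X t; μ] = cov[Y s, Y t; μ]) :
    μ.map (fun ω t => X t ω) = μ.map (fun ω t => Y t ω) := by
  classical
  -- A continuous linear functional of finitely many coordinates is a finite linear combination.
  have hLX : ∀ (Z : T → Ω → ℝ) (I : Finset T) (L : StrongDual ℝ (I → ℝ)),
      (L ∘ fun ω => I.restrict (Z · ω)) = fun ω => ∑ i : I, L (Pi.single i 1) * Z i ω := by
    intro Z I L
    ext ω
    have h := (pi_eq_sum_univ' (I.restrict (Z · ω)))
    simp only [Function.comp]
    conv_lhs => rw [h]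
    rw [map_sum]
    refine Finset.sum_congr rfl fun i _ => ?_
    rw [map_smul, smul_eq_mul, mul_comm]
    rfl
  refine (map_eq_iff_forall_finset_map_restrict_eq
    (measurable_pi_lambda _ hXm).aemeasurable (measurable_pi_lambda _ hYm).aemeasurable).2
    fun I => ?_
  have := (hX.hasGaussianLaw I).isGaussian_map
  have := (hY.hasGaussianLaw I).isGaussian_map
  refine Measure.ext_of_charFunDual ?_
  ext L
  have mean : ∀ Z : T → Ω → ℝ, IsGaussianProcess Z μ → (∀ t, ∫ ω, Z t ω ∂μ = 0) →
      ∫ ω, (L ∘ fun ω => I.restrict (Z · ω)) ω ∂μ = 0 := by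
    intro Z hZ h0
    simp only [hLX Z I L]
    have hi : ∀ i ∈ (Finset.univ : Finset I),
        Integrable (fun ω => L (Pi.single i 1) * Z i ω) μ := fun i _ =>
      ((hZ.hasGaussianLaw_eval i).memLp_two.integrable one_le_two).const_mul _
    rw [integral_finsetSum _ hi]
    simp [integral_const_mul, h0]
  have var : ∀ Z : T → Ω → ℝ, IsGaussianProcess Z μ →
      Var[L ∘ fun ω => I.restrict (Z · ω); μ] = ∑ i : I, ∑ j : I,
        L (Pi.single j 1) * (L (Pi.single i 1) * cov[Z i, Z j; μ]) := by
    intro Z hZ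
    have hm : ∀ i : I, MemLp (fun ω => L (Pi.single i 1) * Z i ω) 2 μ := fun i =>
      (hZ.hasGaussianLaw_eval i).memLp_two.const_mul _
    rw [← covariance_self ((hZ.hasGaussianLaw I).map L).aemeasurable, hLX Z I L,
      covariance_fun_sum_fun_sum hm hm]
    simp [covariance_const_mul_left, covariance_const_mul_right]
  rw [(hX.hasGaussianLaw I).charFunDual_map_eq, (hY.hasGaussianLaw I).charFunDual_map_eq,
    var X hX, var Y hY, mean X hX hX0, mean Y hY hY0]
  simp_rw [hcov]

end

section

variable {Ω : Type*}

/-! ### Linear combinations of the sources -/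

/-- The covariances of the sources: everything is uncorrelated except possibly `θ₀` and the initial
agent state, whose covariance is `c`. The initial agent state has variance `v` and the quantization
noise has variance `ζ`. -/
def sourceCov (η σ c v ζ : ℝ) : Source → Source → ℝ
  | .theta, .theta => 1
  | .theta, .agent => c
  | .agent, .theta => c
  | .agent, .agent => v
  | .process s, .process t => if s = t then 1 - η ^ 2 else 0
  | .observation s, .observation t => if s = t then σ ^ 2 else 0
  | .quantization s, .quantization t => if s = t then ζ else 0
  | _, _ => 0

theorem sourceCov_comm (η σ c v ζ : ℝ) (s t : Source) :
    sourceCov η σ c v ζ s t = sourceCov η σ c v ζ t s := by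
  cases s <;> cases t <;> simp [sourceCov, eq_comm]

/-- The covariance of formal linear combinations of the sources. -/
noncomputable def covForm (η σ c v ζ : ℝ) : (Source →₀ ℝ) →ₗ[ℝ] (Source →₀ ℝ) →ₗ[ℝ] ℝ :=
  Finsupp.linearCombination ℝ fun s => Finsupp.linearCombination ℝ (sourceCov η σ c v ζ s)

/-- A source, as a formal linear combination of the sources. -/
noncomputable def src (s : Source) : Source →₀ ℝ := Finsupp.single s 1

@[simp]
theorem covForm_src (η σ c v ζ : ℝ) (s t : Source) :
    covForm η σ c v ζ (src s) (src t) = sourceCov η σ c v ζ s t := by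
  simp [covForm, src]

theorem covForm_apply (η σ c v ζ : ℝ) (x y : Source →₀ ℝ) :
    covForm η σ c v ζ x y
      = ∑ s ∈ x.support, ∑ t ∈ y.support, x s * (y t * sourceCov η σ c v ζ s t) := by
  simp [covForm, Finsupp.linearCombination_apply, Finsupp.sum, LinearMap.sum_apply,
    Finset.mul_sum]

theorem covForm_comm (η σ c v ζ : ℝ) (x y : Source →₀ ℝ) :
    covForm η σ c v ζ x y = covForm η σ c v ζ y x := by
  rw [covForm_apply, covForm_apply, Finset.sum_comm]
  refine Finset.sum_congr rfl fun s _ => Finset.sum_congr rfl fun t _ => ?_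
  rw [sourceCov_comm]; ring

theorem covForm_add_self {η σ c v ζ : ℝ} {x y : Source →₀ ℝ} (h : covForm η σ c v ζ x y = 0) :
    covForm η σ c v ζ (x + y) (x + y) = covForm η σ c v ζ x x + covForm η σ c v ζ y y := by
  have h' := (covForm_comm η σ c v ζ y x).trans h
  simp only [map_add, LinearMap.add_apply, h, h']
  ring

theorem covForm_eq_zero_of_supported {η σ c v ζ : ℝ} {S T : Set Source}
    (h : ∀ s ∈ S, ∀ t ∈ T, sourceCov η σ c v ζ s t = 0) {x y : Source →₀ ℝ}
    (hx : x ∈ Finsupp.supported ℝ ℝ S) (hy : y ∈ Finsupp.supported ℝ ℝ T) :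
    covForm η σ c v ζ x y = 0 := by
  rw [Finsupp.mem_supported] at hx hy
  rw [covForm_apply]
  exact Finset.sum_eq_zero fun s hs => Finset.sum_eq_zero fun t ht => by
    rw [h s (hx hs) t (hy ht), mul_zero, mul_zero]

theorem src_mem_supported {S : Set Source} {s : Source} (h : s ∈ S) :
    src s ∈ Finsupp.supported ℝ ℝ S :=
  Finsupp.single_mem_supported ℝ 1 h

/-- The time at which a source enters the dynamics. -/
def Source.time : Source → ℕ
  | .theta => 0
  | .agent => 0
  | .process t => t
  | .observation t => t
  | .quantization t => t

/-- The formal linear combinations of the sources with time at most `t`. -/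
noncomputable def past (t : ℕ) : Submodule ℝ (Source →₀ ℝ) :=
  Finsupp.supported ℝ ℝ {s | s.time ≤ t}

theorem past_mono {s t : ℕ} (h : s ≤ t) : past s ≤ past t :=
  Finsupp.supported_mono fun _ hs => le_trans hs h

theorem src_mem_past {s : Source} {t : ℕ} (h : s.time ≤ t) : src s ∈ past t :=
  src_mem_supported h

/-- Fresh noise is uncorrelated with the past. -/
theorem covForm_past {η σ c v ζ : ℝ} {t : ℕ} {x : Source →₀ ℝ} (hx : x ∈ past t) {s : Source}
    (hs : t < s.time) : covForm η σ c v ζ x (src s) = 0 := by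
  refine covForm_eq_zero_of_supported (S := {s | s.time ≤ t}) (T := {s}) ?_ hx
    (src_mem_supported rfl)
  rintro a ha b rfl
  simp only [mem_ofPred_eq] at ha
  cases a <;> cases b <;> simp_all [sourceCov, Source.time] <;> omega

/-- `θ_t` as a formal linear combination of the sources. -/
noncomputable def latentVec (η : ℝ) : ℕ → Source →₀ ℝ
  | 0 => src .theta
  | t + 1 => η • latentVec η t + src (.process (t + 1))

/-- `Y_t` as a formal linear combination of the sources. -/
noncomputable def labelVec (η : ℝ) : ℕ → Source →₀ ℝ
  | 0 => 0
  | t + 1 => latentVec η t + src (.observation (t + 1))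

/-- `U_t` as a formal linear combination of the sources. -/
noncomputable def stateVec (η α δ : ℝ) : ℕ → Source →₀ ℝ
  | 0 => src .agent
  | t + 1 => (1 - α) • stateVec η α δ t + α • labelVec η (t + 1) + δ • src (.quantization (t + 1))

theorem latentVec_mem_past (η : ℝ) (t : ℕ) : latentVec η t ∈ past t := by
  induction t with
  | zero => exact src_mem_past le_rfl
  | succ t ih =>
    exact add_mem (Submodule.smul_mem _ _ (past_mono t.le_succ ih)) (src_mem_past le_rfl)

theorem labelVec_mem_past (η : ℝ) (t : ℕ) : labelVec η t ∈ past t := by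
  cases t with
  | zero => exact zero_mem _
  | succ t =>
    exact add_mem (past_mono t.le_succ (latentVec_mem_past η t)) (src_mem_past le_rfl)

theorem stateVec_mem_past (η α δ : ℝ) (t : ℕ) : stateVec η α δ t ∈ past t := by
  induction t with
  | zero => exact src_mem_past le_rfl
  | succ t ih =>
    exact add_mem (add_mem (Submodule.smul_mem _ _ (past_mono t.le_succ ih))
      (Submodule.smul_mem _ _ (labelVec_mem_past η _)))
      (Submodule.smul_mem _ _ (src_mem_past le_rfl))

theorem linearCombination_src (ξ : Source → Ω → ℝ) (s : Source) :
    Finsupp.linearCombination ℝ ξ (src s) = ξ s := by simp [src]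

theorem linearCombination_latentVec (η : ℝ) (ξ : Source → Ω → ℝ) (t : ℕ) :
    Finsupp.linearCombination ℝ ξ (latentVec η t) = latent η ξ t := by
  induction t with
  | zero => simp [latentVec, latent, linearCombination_src]
  | succ t ih =>
    ext ω
    simp [latentVec, latent, ih, linearCombination_src]

theorem linearCombination_labelVec (η : ℝ) (ξ : Source → Ω → ℝ) (t : ℕ) :
    Finsupp.linearCombination ℝ ξ (labelVec η t) = label η ξ t := by
  cases t with
  | zero => simp [labelVec, label]
  | succ t =>
    ext ω
    simp [labelVec, label, linearCombination_latentVec, linearCombination_src]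

theorem linearCombination_stateVec (η : ℝ) (ξ : Source → Ω → ℝ) (α δ : ℝ) (t : ℕ) :
    Finsupp.linearCombination ℝ ξ (stateVec η α δ t) = state η ξ α δ t := by
  induction t with
  | zero => simp [stateVec, state, stateFrom, linearCombination_src]
  | succ t ih =>
    ext ω
    simp only [state] at ih
    simp [stateVec, state, stateFrom, ih, linearCombination_labelVec, linearCombination_src]
    ring

/-! ### Second moments of the latent process and of the agent state -/

/-- `Cov(θ_t, U_t)`, started at `c`. -/
noncomputable def crossCov (η α c : ℝ) : ℕ → ℝ
  | 0 => c
  | t + 1 => η * ((1 - α) * crossCov η α c t + α)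

/-- `Var U_t`, started at `v`, when `Cov(θ₀, U₀) = c` and the quantization noise has
variance `ζ`. -/
noncomputable def stateVar (η σ α δ c v ζ : ℝ) : ℕ → ℝ
  | 0 => v
  | t + 1 => (1 - α) ^ 2 * stateVar η σ α δ c v ζ t + α ^ 2 * (1 + σ ^ 2)
      + 2 * α * (1 - α) * crossCov η α c t + δ ^ 2 * ζ

theorem covForm_latentVec_self (η σ c v ζ : ℝ) (t : ℕ) :
    covForm η σ c v ζ (latentVec η t) (latentVec η t) = 1 := by
  induction t with
  | zero => simp [latentVec, sourceCov]
  | succ t ih =>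
    have h1 : covForm η σ c v ζ (latentVec η t) (src (.process (t + 1))) = 0 :=
      covForm_past (latentVec_mem_past η t) t.lt_succ_self
    have h2 := (covForm_comm η σ c v ζ _ _).trans h1
    simp only [latentVec, map_add, map_smul, LinearMap.add_apply, LinearMap.smul_apply, ih, h1, h2,
      covForm_src, sourceCov, smul_eq_mul, if_true]
    ring

theorem covForm_latentVec_stateVec (η σ α δ c v ζ : ℝ) (t : ℕ) :
    covForm η σ c v ζ (latentVec η t) (stateVec η α δ t) = crossCov η α c t := by
  induction t with
  | zero => simp [latentVec, stateVec, crossCov, sourceCov]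
  | succ t ih =>
    have h1 : covForm η σ c v ζ (latentVec η t) (src (.observation (t + 1))) = 0 :=
      covForm_past (latentVec_mem_past η t) t.lt_succ_self
    have h2 : covForm η σ c v ζ (latentVec η t) (src (.quantization (t + 1))) = 0 :=
      covForm_past (latentVec_mem_past η t) t.lt_succ_self
    have h3 : covForm η σ c v ζ (src (.process (t + 1))) (latentVec η t) = 0 :=
      (covForm_comm η σ c v ζ _ _).trans (covForm_past (latentVec_mem_past η t) t.lt_succ_self)
    have h4 : covForm η σ c v ζ (src (.process (t + 1))) (stateVec η α δ t) = 0 :=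
      (covForm_comm η σ c v ζ _ _).trans (covForm_past (stateVec_mem_past η α δ t) t.lt_succ_self)
    simp only [latentVec, stateVec, labelVec, map_add, map_smul, LinearMap.add_apply,
      LinearMap.smul_apply, ih, h1, h2, h3, h4, covForm_latentVec_self, covForm_src, sourceCov,
      smul_eq_mul, crossCov]
    ring

theorem covForm_stateVec_self (η σ α δ c v ζ : ℝ) (t : ℕ) :
    covForm η σ c v ζ (stateVec η α δ t) (stateVec η α δ t) = stateVar η σ α δ c v ζ t := by
  induction t with
  | zero => simp [stateVec, stateVar, sourceCov]
  | succ t ih =>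
    have h0 := covForm_latentVec_stateVec η σ α δ c v ζ t
    have h0' := (covForm_comm η σ c v ζ _ _).trans h0
    have h1 : covForm η σ c v ζ (latentVec η t) (src (.observation (t + 1))) = 0 :=
      covForm_past (latentVec_mem_past η t) t.lt_succ_self
    have h1' := (covForm_comm η σ c v ζ _ _).trans h1
    have h2 : covForm η σ c v ζ (latentVec η t) (src (.quantization (t + 1))) = 0 :=
      covForm_past (latentVec_mem_past η t) t.lt_succ_self
    have h2' := (covForm_comm η σ c v ζ _ _).trans h2
    have h3 : covForm η σ c v ζ (stateVec η α δ t) (src (.observation (t + 1))) = 0 :=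
      covForm_past (stateVec_mem_past η α δ t) t.lt_succ_self
    have h3' := (covForm_comm η σ c v ζ _ _).trans h3
    have h4 : covForm η σ c v ζ (stateVec η α δ t) (src (.quantization (t + 1))) = 0 :=
      covForm_past (stateVec_mem_past η α δ t) t.lt_succ_self
    have h4' := (covForm_comm η σ c v ζ _ _).trans h4
    simp only [stateVec, labelVec, map_add, map_smul, LinearMap.add_apply,
      LinearMap.smul_apply, ih, h0, h0', h1, h1', h2, h2', h3, h3', h4, h4',
      covForm_latentVec_self, covForm_src, sourceCov, smul_eq_mul, stateVar, if_true]
    ring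

/-- `Var(U_t | H_t)` when `U₀` has variance `1` and is independent of the environment: the variance
of `residVec`. -/
noncomputable def residVar (α δ : ℝ) : ℕ → ℝ
  | 0 => 1
  | t + 1 => (1 - α) ^ 2 * residVar α δ t + δ ^ 2

/-- The part of `U_t` that does not come from the labels. -/
noncomputable def residVec (α δ : ℝ) : ℕ → Source →₀ ℝ
  | 0 => src .agent
  | t + 1 => (1 - α) • residVec α δ t + δ • src (.quantization (t + 1))

/-- The linear combinations of the labels `Y_1, …, Y_t`. -/
noncomputable def labelSpan (η : ℝ) (t : ℕ) : Submodule ℝ (Source →₀ ℝ) :=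
  Submodule.span ℝ (range fun i : Fin t => labelVec η (i + 1))

theorem labelVec_mem_labelSpan (η : ℝ) {i t : ℕ} (h : i < t) : labelVec η (i + 1) ∈ labelSpan η t :=
  Submodule.subset_span ⟨⟨i, h⟩, rfl⟩

theorem labelSpan_le {η : ℝ} {t : ℕ} {p : Submodule ℝ (Source →₀ ℝ)}
    (h : ∀ i < t, labelVec η (i + 1) ∈ p) : labelSpan η t ≤ p :=
  Submodule.span_le.2 (by rintro _ ⟨i, rfl⟩; exact h i i.2)

theorem labelSpan_mono (η : ℝ) {s t : ℕ} (h : s ≤ t) : labelSpan η s ≤ labelSpan η t :=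
  labelSpan_le fun _ hi => labelVec_mem_labelSpan η (hi.trans_le h)

theorem residVec_mem_past (α δ : ℝ) (t : ℕ) : residVec α δ t ∈ past t := by
  induction t with
  | zero => exact src_mem_past le_rfl
  | succ t ih =>
    exact add_mem (Submodule.smul_mem _ _ (past_mono t.le_succ ih))
      (Submodule.smul_mem _ _ (src_mem_past le_rfl))

/-- Up to `residVec`, the agent state is a linear combination of the labels. -/
theorem stateVec_sub_residVec_mem (η α δ : ℝ) (t : ℕ) :
    stateVec η α δ t - residVec α δ t ∈ labelSpan η t := by
  induction t with
  | zero => simp [stateVec, residVec]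
  | succ t ih =>
    have h : stateVec η α δ (t + 1) - residVec α δ (t + 1)
        = (1 - α) • (stateVec η α δ t - residVec α δ t) + α • labelVec η (t + 1) := by
      simp only [stateVec, residVec]; module
    rw [h]
    exact add_mem (Submodule.smul_mem _ _ (labelSpan_mono η t.le_succ ih))
      (Submodule.smul_mem _ _ (labelVec_mem_labelSpan η t.lt_succ_self))

theorem covForm_residVec_self (η σ c α δ : ℝ) (t : ℕ) :
    covForm η σ c 1 1 (residVec α δ t) (residVec α δ t) = residVar α δ t := by
  induction t with
  | zero => simp [residVec, residVar, sourceCov]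
  | succ t ih =>
    have h1 : covForm η σ c 1 1 (residVec α δ t) (src (.quantization (t + 1))) = 0 :=
      covForm_past (residVec_mem_past α δ t) t.lt_succ_self
    have h2 := (covForm_comm η σ c 1 1 _ _).trans h1
    simp only [residVec, map_add, map_smul, LinearMap.add_apply, LinearMap.smul_apply, ih, h1, h2,
      covForm_src, sourceCov, smul_eq_mul, if_true, residVar]
    ring

/-- The sources that drive the environment, as opposed to the agent. -/
def envSources : Set Source := {s | match s with
  | .theta => True
  | .process _ => True
  | .observation _ => True
  | _ => False}

theorem latentVec_mem_env (η : ℝ) (t : ℕ) :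
    latentVec η t ∈ Finsupp.supported ℝ ℝ envSources := by
  induction t with
  | zero => exact src_mem_supported trivial
  | succ t ih => exact add_mem (Submodule.smul_mem _ _ ih) (src_mem_supported trivial)

theorem labelVec_mem_env (η : ℝ) (t : ℕ) :
    labelVec η t ∈ Finsupp.supported ℝ ℝ envSources := by
  cases t with
  | zero => exact zero_mem _
  | succ t => exact add_mem (latentVec_mem_env η t) (src_mem_supported trivial)

theorem residVec_mem_compl_env (α δ : ℝ) (t : ℕ) :
    residVec α δ t ∈ Finsupp.supported ℝ ℝ envSourcesᶜ := by
  induction t with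
  | zero => exact src_mem_supported id
  | succ t ih =>
    exact add_mem (Submodule.smul_mem _ _ ih) (Submodule.smul_mem _ _ (src_mem_supported id))

theorem covForm_env_compl {η σ v ζ : ℝ} {x y : Source →₀ ℝ}
    (hx : x ∈ Finsupp.supported ℝ ℝ envSources) (hy : y ∈ Finsupp.supported ℝ ℝ envSourcesᶜ) :
    covForm η σ 0 v ζ x y = 0 := by
  refine covForm_eq_zero_of_supported ?_ hx hy
  intro a ha b hb
  cases a <;> cases b <;> simp_all [sourceCov, envSources]

/-! ### The Kalman filter -/

/-- The prediction variance `Var(θ_t | H_t)`, given by the Riccati recursion. -/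
noncomputable def kalmanVar (η σ : ℝ) : ℕ → ℝ
  | 0 => 1
  | t + 1 => η ^ 2 * (kalmanVar η σ t * σ ^ 2 / (kalmanVar η σ t + σ ^ 2)) + (1 - η ^ 2)

/-- The Kalman predictor `E[θ_t | H_t]`. -/
noncomputable def kalmanVec (η σ : ℝ) : ℕ → Source →₀ ℝ
  | 0 => 0
  | t + 1 => η • (kalmanVec η σ t + (kalmanVar η σ t / (kalmanVar η σ t + σ ^ 2)) •
      (labelVec η (t + 1) - kalmanVec η σ t))

theorem kalmanVar_pos {η σ : ℝ} (hη : η ^ 2 < 1) (t : ℕ) : 0 < kalmanVar η σ t := by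
  induction t with
  | zero => exact one_pos
  | succ t ih =>
    have : 0 < 1 - η ^ 2 := by linarith
    rw [kalmanVar]
    positivity

theorem kalmanVec_mem_labelSpan (η σ : ℝ) (t : ℕ) : kalmanVec η σ t ∈ labelSpan η t := by
  induction t with
  | zero => exact zero_mem _
  | succ t ih =>
    have ih' := labelSpan_mono η t.le_succ ih
    exact Submodule.smul_mem _ _ (add_mem ih' (Submodule.smul_mem _ _
      (sub_mem (labelVec_mem_labelSpan η t.lt_succ_self) ih')))

/-- The orthogonality principle for the Kalman filter: its prediction error has variance
`kalmanVar` and is uncorrelated with the labels seen so far. -/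
theorem covForm_kalman_error {η σ : ℝ} (hη : η ^ 2 < 1) (hσ : 0 < σ) (c v ζ : ℝ) (t : ℕ) :
    (∀ x ∈ labelSpan η t, covForm η σ c v ζ (latentVec η t - kalmanVec η σ t) x = 0) ∧
      covForm η σ c v ζ (latentVec η t - kalmanVec η σ t) (latentVec η t - kalmanVec η σ t)
        = kalmanVar η σ t := by
  induction t with
  | zero =>
    refine ⟨fun x hx => ?_, by simp [latentVec, kalmanVec, kalmanVar, sourceCov]⟩
    have : labelSpan η 0 = ⊥ := by simp [labelSpan]
    rw [this, Submodule.mem_bot] at hx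
    simp [hx]
  | succ t ih =>
    obtain ⟨ih1, ih2⟩ := ih
    have hP := kalmanVar_pos (σ := σ) hη t
    set P := kalmanVar η σ t with hPdef
    set e := latentVec η t - kalmanVec η σ t with he
    have hPs : P + σ ^ 2 ≠ 0 := by positivity
    set K := P / (P + σ ^ 2) with hK
    -- The prediction error has a recursion of its own, in which the labels no longer occur.
    have hrec : latentVec η (t + 1) - kalmanVec η σ (t + 1)
        = (η * (1 - K)) • e + src (.process (t + 1)) - (η * K) • src (.observation (t + 1)) := by
      simp only [latentVec, kalmanVec, labelVec, ← hPdef, ← hK, he]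
      module
    have hepast : e ∈ past t := sub_mem (latentVec_mem_past η t)
      (labelSpan_le (fun i hi => past_mono hi (labelVec_mem_past η _))
        (kalmanVec_mem_labelSpan η σ t))
    have hB1 : ∀ x ∈ past t, covForm η σ c v ζ x (src (.process (t + 1))) = 0 := fun x hx =>
      covForm_past hx t.lt_succ_self
    have hB2 : ∀ x ∈ past t, covForm η σ c v ζ x (src (.observation (t + 1))) = 0 := fun x hx =>
      covForm_past hx t.lt_succ_self
    have hB1' : ∀ x ∈ past t, covForm η σ c v ζ (src (.process (t + 1))) x = 0 := fun x hx =>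
      (covForm_comm η σ c v ζ _ _).trans (hB1 x hx)
    have hB2' : ∀ x ∈ past t, covForm η σ c v ζ (src (.observation (t + 1))) x = 0 := fun x hx =>
      (covForm_comm η σ c v ζ _ _).trans (hB2 x hx)
    refine ⟨fun x hx => ?_, ?_⟩
    · rw [← LinearMap.mem_ker]
      refine labelSpan_le (fun i hi => ?_) hx
      rw [LinearMap.mem_ker]
      rcases Nat.lt_succ_iff_lt_or_eq.1 hi with hi | rfl
      · have hl : labelVec η (i + 1) ∈ past t := past_mono hi (labelVec_mem_past η _)
        simp only [hrec, map_add, map_sub, map_smul, LinearMap.add_apply, LinearMap.sub_apply,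
          LinearMap.smul_apply, ih1 _ (labelVec_mem_labelSpan η hi), hB1' _ hl, hB2' _ hl]
        simp
      · have hl : labelVec η (i + 1) = e + kalmanVec η σ i + src (.observation (i + 1)) := by
          simp only [labelVec, he]; abel
        have hk : kalmanVec η σ i ∈ past i := by
          simpa [he] using sub_mem (latentVec_mem_past η i) hepast
        simp only [hrec, hl, map_add, map_sub, map_smul, LinearMap.add_apply, LinearMap.sub_apply,
          LinearMap.smul_apply, ih2, ih1 _ (kalmanVec_mem_labelSpan η σ i), hB1' _ hepast,
          hB2' _ hepast, hB1' _ hk, hB2' _ hk, hB2 _ hepast, covForm_src, sourceCov, smul_eq_mul,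
          if_true, hK]
        field_simp
        ring
    · simp only [hrec, map_add, map_sub, map_smul, LinearMap.add_apply, LinearMap.sub_apply,
        LinearMap.smul_apply, ih2, hB1' _ hepast, hB2' _ hepast, hB1 _ hepast, hB2 _ hepast,
        covForm_src, sourceCov, smul_eq_mul, if_true, hK, kalmanVar, ← hPdef]
      field_simp
      ring

end

section

variable {Ω : Type*} [MeasurableSpace Ω]

/-! ### Gaussian sources -/

theorem measurable_linearCombination {ξ : Source → Ω → ℝ} (h : ∀ s, Measurable (ξ s))
    (x : Source →₀ ℝ) :
    Measurable (Finsupp.linearCombination ℝ ξ x) := by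
  have hsum : Finsupp.linearCombination ℝ ξ x = fun ω => ∑ s ∈ x.support, x s • ξ s ω := by
    ext ω
    simp [Finsupp.linearCombination_apply, Finsupp.sum]
  rw [hsum]
  exact Finset.measurable_sum _ fun s _ => (h s).const_smul (x s)

theorem measurable_label {ξ : Source → Ω → ℝ} (h : ∀ s, Measurable (ξ s)) (η : ℝ) (t : ℕ) :
    Measurable (label η ξ t) :=
  linearCombination_labelVec η ξ t ▸ measurable_linearCombination h _

theorem measurable_state {ξ : Source → Ω → ℝ} (h : ∀ s, Measurable (ξ s)) (η α δ : ℝ) (t : ℕ) :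
    Measurable (state η ξ α δ t) :=
  linearCombination_stateVec η ξ α δ t ▸ measurable_linearCombination h _

theorem measurable_history {ξ : Source → Ω → ℝ} (h : ∀ s, Measurable (ξ s)) (η : ℝ) (t : ℕ) :
    Measurable (history η ξ t) :=
  measurable_pi_lambda _ fun _ => measurable_label h _ _

/-- The sources form a Gaussian process with covariances `sourceCov η σ c v ζ`. In contrast to
`IsDriving`, the initial agent state may be correlated with `θ₀`, and means are arbitrary. -/
structure IsGaussianDriving (η σ c v ζ : ℝ) (μ : Measure Ω) (ξ : Source → Ω → ℝ) : Prop where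
  measurable : ∀ s, Measurable (ξ s)
  gaussian : IsGaussianProcess ξ μ
  cov : ∀ s t, cov[ξ s, ξ t; μ] = sourceCov η σ c v ζ s t

namespace IsGaussianDriving

variable {η σ c v ζ : ℝ} {μ : Measure Ω} {ξ : Source → Ω → ℝ}

theorem isGaussianProcess_linearCombination (h : IsGaussianDriving η σ c v ζ μ ξ) {ι : Type*}
    (x : ι → Source →₀ ℝ) :
    IsGaussianProcess (fun i => Finsupp.linearCombination ℝ ξ (x i)) μ := by
  refine IsGaussianProcess.of_isGaussianProcess h.gaussian fun i =>
    ⟨(x i).support, ∑ s : (x i).support, x i s • ContinuousLinearMap.proj s, fun ω => ?_⟩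
  rw [Finsupp.linearCombination_apply, Finsupp.sum, Finset.sum_apply, ← Finset.sum_coe_sort]
  simp

variable [IsProbabilityMeasure μ]

theorem covariance_linearCombination (h : IsGaussianDriving η σ c v ζ μ ξ) (x y : Source →₀ ℝ) :
    cov[Finsupp.linearCombination ℝ ξ x, Finsupp.linearCombination ℝ ξ y; μ]
      = covForm η σ c v ζ x y := by
  have hm : ∀ (a : ℝ) (s : Source), MemLp (a • ξ s) 2 μ := fun a s =>
    (h.gaussian.hasGaussianLaw_eval s).memLp_two.const_smul a
  rw [Finsupp.linearCombination_apply, Finsupp.sum, Finsupp.linearCombination_apply, Finsupp.sum,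
    covariance_sum_sum' (fun s _ => hm _ s) (fun s _ => hm _ s), covForm_apply]
  simp_rw [covariance_smul_left, covariance_smul_right, h.cov]

/-- Uncorrelated families of linear combinations of the sources are independent. -/
theorem indepFun_linearCombination (h : IsGaussianDriving η σ c v ζ μ ξ) {ι κ : Type*}
    (x : ι → Source →₀ ℝ) (y : κ → Source →₀ ℝ)
    (hxy : ∀ i j, covForm η σ c v ζ (x i) (y j) = 0) :
    IndepFun (fun ω i => Finsupp.linearCombination ℝ ξ (x i) ω)
      (fun ω j => Finsupp.linearCombination ℝ ξ (y j) ω) μ := by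
  refine IsGaussianProcess.indepFun_of_covariance_eq_zero ?_
    (fun i => (measurable_linearCombination h.measurable _).aemeasurable)
    (fun i => (measurable_linearCombination h.measurable _).aemeasurable)
    fun i j => (h.covariance_linearCombination _ _).trans (hxy i j)
  convert! h.isGaussianProcess_linearCombination (Sum.elim x y) using 2 with i
  cases i <;> rfl

theorem map_linearCombination (h : IsGaussianDriving η σ c v ζ μ ξ) (x : Source →₀ ℝ) :
    μ.map (Finsupp.linearCombination ℝ ξ x) = gaussianReal
      (∫ ω, Finsupp.linearCombination ℝ ξ x ω ∂μ) (covForm η σ c v ζ x x).toNNReal := by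
  rw [((h.isGaussianProcess_linearCombination fun _ : Unit => x).hasGaussianLaw_eval
    ()).map_eq_gaussianReal, ← h.covariance_linearCombination,
    covariance_self (measurable_linearCombination h.measurable x).aemeasurable]

theorem integral_linearCombination (h : IsGaussianDriving η σ c v ζ μ ξ)
    (h0 : ∀ s, ∫ ω, ξ s ω ∂μ = 0) (x : Source →₀ ℝ) :
    ∫ ω, Finsupp.linearCombination ℝ ξ x ω ∂μ = 0 := by
  have hi : ∀ s ∈ x.support, Integrable (fun ω => x s * ξ s ω) μ := fun s _ =>
    ((h.gaussian.hasGaussianLaw_eval s).memLp_two.integrable one_le_two).const_mul _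
  simp only [Finsupp.linearCombination_apply, Finsupp.sum, Finset.sum_apply, Pi.smul_apply,
    smul_eq_mul]
  rw [integral_finsetSum _ hi]
  simp [integral_const_mul, h0]

theorem covForm_self_nonneg (h : IsGaussianDriving η σ c v ζ μ ξ) (x : Source →₀ ℝ) :
    0 ≤ covForm η σ c v ζ x x := by
  rw [← h.covariance_linearCombination,
    covariance_self (measurable_linearCombination h.measurable x).aemeasurable]
  exact variance_nonneg _ _

theorem map_linearCombination_of_centered (h : IsGaussianDriving η σ c v ζ μ ξ)
    (h0 : ∀ s, ∫ ω, ξ s ω ∂μ = 0) {x : Source →₀ ℝ} {X : Ω → ℝ}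
    (hX : X = Finsupp.linearCombination ℝ ξ x) :
    μ.map X = gaussianReal 0 (covForm η σ c v ζ x x).toNNReal := by
  rw [hX, h.map_linearCombination, h.integral_linearCombination h0]

end IsGaussianDriving

theorem history_eq {Ω : Type*} (η : ℝ) (ξ : Source → Ω → ℝ) (t : ℕ) :
    history η ξ t = fun ω (i : Fin t) => Finsupp.linearCombination ℝ ξ (labelVec η (i + 1)) ω := by
  ext ω i
  rw [linearCombination_labelVec]; rfl

/-- Linear combinations of the labels seen so far are functions of the history. -/
theorem exists_eq_history {η : ℝ} {t : ℕ} {x : Source →₀ ℝ} (hx : x ∈ labelSpan η t)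
    {Ω : Type*} (ξ : Source → Ω → ℝ) : ∃ f : (Fin t → ℝ) → ℝ, Measurable f ∧
      ∀ ω, f (history η ξ t ω) = Finsupp.linearCombination ℝ ξ x ω := by
  obtain ⟨a, rfl⟩ := (Submodule.mem_span_range_iff_exists_fun ℝ).1 hx
  refine ⟨fun h => ∑ i, a i * h i, by fun_prop, fun ω => ?_⟩
  simp [map_sum, history_eq η ξ t]

namespace IsDriving

variable {η σ : ℝ} {μ : Measure Ω} {ξ : Source → Ω → ℝ}

theorem integral_eq_zero (h : IsDriving η σ μ ξ) (s : Source) : ∫ ω, ξ s ω ∂μ = 0 := by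
  have := integral_map (h.measurable s).aemeasurable (μ := μ) (f := fun x : ℝ => x) (by fun_prop)
  rw [← this, h.law, integral_id_gaussianReal]

theorem isGaussianDriving (h : IsDriving η σ μ ξ) (hη : η ^ 2 < 1) :
    IsGaussianDriving η σ 0 1 1 μ ξ where
  measurable := h.measurable
  gaussian := by
    constructor
    intro I
    have hI : iIndepFun (fun i : I => ξ i) μ := h.indep.precomp Subtype.val_injective
    refine hI.hasGaussianLaw fun i => ⟨?_⟩
    exact (h.law i).symm ▸ inferInstanceAs (IsGaussian (gaussianReal 0 _))
  cov s t := by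
    have hL : ∀ s, MemLp (ξ s) 2 μ := fun s => by
      have : MemLp (fun x : ℝ => x) 2 (μ.map (ξ s)) := by
        rw [h.law]; exact memLp_id_gaussianReal 2
      exact this.comp_of_map (h.measurable s).aemeasurable
    have hV : ∀ s, cov[ξ s, ξ s; μ] = s.variance η σ := fun s => by
      rw [covariance_self (h.measurable s).aemeasurable]
      have := variance_map (X := fun x : ℝ => x) (μ := μ) (Y := ξ s) (by fun_prop)
        (h.measurable s).aemeasurable
      rw [h.law, variance_fun_id_gaussianReal] at this
      exact this.symm
    have h1 : (Real.toNNReal (1 - η ^ 2) : ℝ) = 1 - η ^ 2 := Real.coe_toNNReal _ (by linarith)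
    have h2 : (Real.toNNReal (σ ^ 2) : ℝ) = σ ^ 2 := Real.coe_toNNReal _ (by positivity)
    by_cases hst : s = t
    · subst hst
      rw [hV]
      cases s <;> simp [Source.variance, sourceCov, -Real.coe_toNNReal', h1, h2]
    · rw [(h.indep.indepFun hst).covariance_eq_zero (hL s) (hL t)]
      cases s <;> cases t <;> simp_all [sourceCov]

end IsDriving

/-! ### Positivity of the variances -/

theorem crossCov_nonneg {η α : ℝ} (hη : 0 ≤ η) (hα : α ∈ Icc (0 : ℝ) 1) (t : ℕ) :
    0 ≤ crossCov η α 0 t := by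
  induction t with
  | zero => exact le_rfl
  | succ t ih =>
    have := sub_nonneg.2 hα.2
    have := hα.1
    rw [crossCov]; positivity

theorem stateVar_pos {η σ α δ : ℝ} (hη : 0 ≤ η) (hα : α ∈ Ioo (0 : ℝ) 1) (t : ℕ) :
    0 < stateVar η σ α δ 0 1 1 t := by
  induction t with
  | zero => exact one_pos
  | succ t ih =>
    have h1 := sub_pos.2 hα.2
    have h2 := hα.1
    have := crossCov_nonneg hη (Ioo_subset_Icc_self hα) t
    rw [stateVar]; positivity

theorem residVar_pos {α δ : ℝ} (hα : α < 1) (t : ℕ) : 0 < residVar α δ t := by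
  induction t with
  | zero => exact one_pos
  | succ t ih =>
    have h1 := sub_pos.2 hα
    rw [residVar]; positivity

/-! ### Content and error at finite times -/

section FiniteTime

variable {η σ : ℝ} {μ : Measure Ω} [IsProbabilityMeasure μ] {ξ : Source → Ω → ℝ}

/-- `I(U_t; H_t) = log (Var U_t / Var(U_t | H_t)) / 2`. -/
theorem informationContent_eq (h : IsDriving η σ μ ξ) (hη₀ : 0 ≤ η) (hη₁ : η ^ 2 < 1) {α δ : ℝ}
    (hα : α ∈ Ioo (0 : ℝ) 1) (t : ℕ) :
    informationContent η μ ξ α δ t = ENNReal.ofReal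
      (Real.log (stateVar η σ α δ 0 1 1 t / residVar α δ t) / 2) := by
  have hg := h.isGaussianDriving hη₁
  have h0 := h.integral_eq_zero
  have hv := stateVar_pos (σ := σ) (δ := δ) hη₀ hα t
  have hq := residVar_pos (δ := δ) hα.2 t
  obtain ⟨f, hf, hfH⟩ := exists_eq_history (stateVec_sub_residVec_mem η α δ t) ξ
  have hres : (fun ω => state η ξ α δ t ω - f (history η ξ t ω))
      = Finsupp.linearCombination ℝ ξ (residVec α δ t) := by
    ext ω
    rw [hfH, ← linearCombination_stateVec, map_sub]
    simp
  have hind : IndepFun (history η ξ t) (fun ω => state η ξ α δ t ω - f (history η ξ t ω)) μ := by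
    rw [hres, history_eq]
    exact (hg.indepFun_linearCombination (fun i : Fin t => labelVec η (i + 1))
      (fun _ : Unit => residVec α δ t) fun i _ => covForm_env_compl (labelVec_mem_env η _)
        (residVec_mem_compl_env α δ t)).comp measurable_id (measurable_pi_apply ())
  have hlaw := hg.map_linearCombination_of_centered h0 hres
  rw [covForm_residVec_self] at hlaw
  have hlawU := hg.map_linearCombination_of_centered h0 (linearCombination_stateVec η ξ α δ t).symm
  rw [covForm_stateVec_self] at hlawU
  rw [informationContent,
    mutualInfo_eq_of_gaussian_regression (measurable_history hg.measurable η t)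
      (measurable_state hg.measurable η α δ t) hf (by simpa using hq) (by simpa using hv) hind
      hlaw hlawU,
    Real.coe_toNNReal _ hv.le, Real.coe_toNNReal _ hq.le]

/-- The informational error is half the logarithm of the ratio of the variances of `Y_{t+1}` given
`U_t` and given `H_t`. The ratio is at least `1`, so no truncation takes place in
`ENNReal.ofReal`. -/
theorem informationalError_eq (h : IsDriving η σ μ ξ) (hη₀ : 0 ≤ η) (hη₁ : η ^ 2 < 1) (hσ : 0 < σ)
    {α δ : ℝ} (hα : α ∈ Ioo (0 : ℝ) 1) (t : ℕ) :
    kalmanVar η σ t + σ ^ 2 ≤ 1 + σ ^ 2 - crossCov η α 0 t ^ 2 / stateVar η σ α δ 0 1 1 t ∧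
    informationalError η μ ξ α δ t = ENNReal.ofReal
      (Real.log ((1 + σ ^ 2 - crossCov η α 0 t ^ 2 / stateVar η σ α δ 0 1 1 t)
        / (kalmanVar η σ t + σ ^ 2)) / 2) := by
  have hg := h.isGaussianDriving hη₁
  have h0 := h.integral_eq_zero
  have hv := stateVar_pos (σ := σ) (δ := δ) hη₀ hα t
  have hP := kalmanVar_pos (σ := σ) hη₁ t
  set x := latentVec η t with hx
  set u := stateVec η α δ t with hu
  set m := kalmanVec η σ t with hm
  set o := src (.observation (t + 1)) with ho
  set κ := crossCov η α 0 t / stateVar η σ α δ 0 1 1 t with hκ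
  obtain ⟨k1, k2⟩ := covForm_kalman_error hη₁ hσ 0 1 1 t
  rw [← hx, ← hm] at k1 k2
  have hmpast : m ∈ past t := labelSpan_le (fun i hi => past_mono hi (labelVec_mem_past η _))
    (kalmanVec_mem_labelSpan η σ t)
  have ho' : ∀ y ∈ past t, covForm η σ 0 1 1 o y = 0 := fun y hy =>
    (covForm_comm η σ 0 1 1 _ _).trans (covForm_past hy t.lt_succ_self)
  have hoo : covForm η σ 0 1 1 o o = σ ^ 2 := by simp [ho, sourceCov]
  -- The Kalman innovation is uncorrelated with the history and with the agent state.
  have hinnov : ∀ y ∈ labelSpan η t, covForm η σ 0 1 1 (x - m + o) y = 0 := fun y hy => by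
    rw [map_add, LinearMap.add_apply, k1 y hy, ho' y (labelSpan_le
      (fun i hi => past_mono hi (labelVec_mem_past η _)) hy), add_zero]
  have hmenv : m ∈ Finsupp.supported ℝ ℝ envSources :=
    labelSpan_le (fun i _ => labelVec_mem_env η _) (kalmanVec_mem_labelSpan η σ t)
  have hinnovU : covForm η σ 0 1 1 (x - m + o) u = 0 := by
    have h1 : u = (u - residVec α δ t) + residVec α δ t := by abel
    rw [h1, map_add, hinnov _ (stateVec_sub_residVec_mem η α δ t), zero_add]
    exact covForm_env_compl (add_mem (sub_mem (latentVec_mem_env η t) hmenv)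
      (src_mem_supported trivial)) (residVec_mem_compl_env α δ t)
  have hinnovSelf : covForm η σ 0 1 1 (x - m + o) (x - m + o) = kalmanVar η σ t + σ ^ 2 := by
    have h1 := ho' _ (sub_mem (latentVec_mem_past η t) hmpast)
    have h2 := (covForm_comm η σ 0 1 1 _ _).trans h1
    rw [covForm_add_self h2, k2, hoo]
  have hxx : covForm η σ 0 1 1 x x = 1 := covForm_latentVec_self η σ 0 1 1 t
  have hxu : covForm η σ 0 1 1 x u = crossCov η α 0 t := covForm_latentVec_stateVec η σ α δ 0 1 1 t
  have hux := (covForm_comm η σ 0 1 1 _ _).trans hxu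
  have huu : covForm η σ 0 1 1 u u = stateVar η σ α δ 0 1 1 t :=
    covForm_stateVec_self η σ α δ 0 1 1 t
  have hou := ho' u (stateVec_mem_past η α δ t)
  have huo := (covForm_comm η σ 0 1 1 _ _).trans hou
  have hox := ho' x (latentVec_mem_past η t)
  have hxo := (covForm_comm η σ 0 1 1 _ _).trans hox
  have hregU : covForm η σ 0 1 1 u (x + o - κ • u) = 0 := by
    simp only [map_add, map_sub, map_smul, hux, huo, huu, smul_eq_mul, hκ]
    field_simp; ring
  have hregSelf : covForm η σ 0 1 1 (x + o - κ • u) (x + o - κ • u)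
      = 1 + σ ^ 2 - crossCov η α 0 t ^ 2 / stateVar η σ α δ 0 1 1 t := by
    simp only [map_add, map_sub, map_smul, LinearMap.add_apply, LinearMap.sub_apply,
      LinearMap.smul_apply, hxx, hxu, hux, hxo, hox, hou, huo, hoo, huu, smul_eq_mul, hκ]
    field_simp; ring
  -- Pythagoras: the two regression errors differ by the orthogonal vector `m - κ u`.
  have hpyth : covForm η σ 0 1 1 (m - κ • u) (m - κ • u)
      = (1 + σ ^ 2 - crossCov η α 0 t ^ 2 / stateVar η σ α δ 0 1 1 t)
        - (kalmanVar η σ t + σ ^ 2) := by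
    have h1 : x + o - κ • u = (x - m + o) + (m - κ • u) := by abel
    have h2 : covForm η σ 0 1 1 (x - m + o) (m - κ • u) = 0 := by
      rw [map_sub, map_smul, hinnov m (kalmanVec_mem_labelSpan η σ t), hinnovU]; simp
    rw [← hregSelf, h1, covForm_add_self h2, hinnovSelf]
    ring
  have hle : kalmanVar η σ t + σ ^ 2
      ≤ 1 + σ ^ 2 - crossCov η α 0 t ^ 2 / stateVar η σ α δ 0 1 1 t := by
    have := hg.covForm_self_nonneg (m - κ • u)
    linarith
  have hs : 0 < kalmanVar η σ t + σ ^ 2 := by positivity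
  have hr := hs.trans_le hle
  refine ⟨hle, ?_⟩
  obtain ⟨f, hf, hfH⟩ := exists_eq_history (kalmanVec_mem_labelSpan η σ t) ξ
  rw [← hm] at hfH
  have hY : ∀ ω, label η ξ (t + 1) ω = Finsupp.linearCombination ℝ ξ (x + o) ω := fun ω => by
    rw [← linearCombination_labelVec]; rfl
  have hU : ∀ ω, state η ξ α δ t ω = Finsupp.linearCombination ℝ ξ u ω := fun ω => by
    rw [← linearCombination_stateVec]
  have heH : (fun ω => label η ξ (t + 1) ω - f (history η ξ t ω))
      = Finsupp.linearCombination ℝ ξ (x - m + o) := by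
    ext ω
    rw [hfH, hY, map_add, map_add, map_sub]
    simp; ring
  have heU : (fun ω => label η ξ (t + 1) ω - κ * state η ξ α δ t ω)
      = Finsupp.linearCombination ℝ ξ (x + o - κ • u) := by
    ext ω
    rw [hU, hY, map_sub, map_smul]
    simp
  have hdiff : (fun ω => f (history η ξ t ω) - κ * state η ξ α δ t ω)
      = Finsupp.linearCombination ℝ ξ (m - κ • u) := by
    ext ω
    rw [hfH, hU, map_sub, map_smul]
    simp
  have hindH : IndepFun (history η ξ t) (fun ω => label η ξ (t + 1) ω - f (history η ξ t ω)) μ := by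
    rw [heH, history_eq]
    exact (hg.indepFun_linearCombination (fun i : Fin t => labelVec η (i + 1))
      (fun _ : Unit => x - m + o) fun i _ => (covForm_comm η σ 0 1 1 _ _).trans
        (hinnov _ (labelVec_mem_labelSpan η i.2))).comp measurable_id (measurable_pi_apply ())
  have hindU : IndepFun (state η ξ α δ t)
      (fun ω => label η ξ (t + 1) ω - κ * state η ξ α δ t ω) μ := by
    rw [heU, ← linearCombination_stateVec]
    exact (hg.indepFun_linearCombination (fun _ : Unit => u)
      (fun _ : Unit => x + o - κ • u) fun _ _ => hregU).comp
        (measurable_pi_apply ()) (measurable_pi_apply ())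
  have hlawH := hg.map_linearCombination_of_centered h0 heH
  have hlawU := hg.map_linearCombination_of_centered h0 heU
  have hlawD := hg.map_linearCombination_of_centered h0 hdiff
  rw [hinnovSelf] at hlawH
  rw [hregSelf] at hlawU
  rw [hpyth] at hlawD
  have hmH := measurable_history hg.measurable η t
  have hmU := measurable_state hg.measurable η α δ t
  obtain ⟨i1, e1⟩ := integral_sq_of_map_eq_gaussianReal (by fun_prop) hlawD
  rw [informationalError, lintegral_klDiv_condDistrib (g := fun u => κ * u) hmH hmU
    (measurable_label hg.measurable _ _) hf (by fun_prop) (by simpa using hs) (by simpa using hr)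
    hindH hlawH hindU hlawU i1, Real.coe_toNNReal _ hs.le, Real.coe_toNNReal _ hr.le]
  rw [e1, Real.coe_toNNReal _ (by linarith), Real.coe_toNNReal _ hs.le, Real.coe_toNNReal _ hr.le]

end FiniteTime

end

section

variable {Ω : Type*} [MeasurableSpace Ω]

/-! ### Limits -/

theorem tendsto_of_affine_recursion {a b : ℝ} (ha₀ : 0 ≤ a) (ha₁ : a < 1) {x y : ℕ → ℝ}
    (hx : ∀ t, x (t + 1) = a * x t + y t) (hy : Tendsto y atTop (𝓝 b)) :
    Tendsto x atTop (𝓝 (b / (1 - a))) := by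
  have h1 : 0 < 1 - a := sub_pos.2 ha₁
  rw [Metric.tendsto_atTop] at hy ⊢
  intro ε hε
  obtain ⟨N, hN⟩ := hy (ε / 2 * (1 - a)) (by positivity)
  set d : ℕ → ℝ := fun n => |x n - b / (1 - a)| with hd
  -- Once `y` is close to its limit, the excess of the distance over `ε / 2` contracts.
  have hstep : ∀ n, d (N + n) ≤ ε / 2 + a ^ n * d N := by
    intro n
    induction n with
    | zero => simp; positivity
    | succ n ih =>
      have hyn : |y (N + n) - b| < ε / 2 * (1 - a) := hN _ (Nat.le_add_right _ _)
      have he : x (N + n + 1) - b / (1 - a)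
          = a * (x (N + n) - b / (1 - a)) + (y (N + n) - b) := by
        rw [hx]; field_simp; ring
      calc d (N + n + 1) ≤ a * d (N + n) + |y (N + n) - b| := by
            simp only [hd, he]
            refine (abs_add_le _ _).trans_eq ?_
            rw [abs_mul, abs_of_nonneg ha₀]
        _ ≤ a * (ε / 2 + a ^ n * d N) + ε / 2 * (1 - a) := by gcongr
        _ = ε / 2 + a ^ (n + 1) * d N := by ring
  have hgeo : Tendsto (fun n => a ^ n * d N) atTop (𝓝 0) := by
    simpa using (tendsto_pow_atTop_nhds_zero_of_lt_one ha₀ ha₁).mul_const (d N)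
  obtain ⟨M, hM⟩ := (hgeo.eventually (gt_mem_nhds (half_pos hε))).exists_forall_of_atTop
  refine ⟨N + M, fun n hn => ?_⟩
  obtain ⟨k, rfl⟩ := Nat.exists_eq_add_of_le hn
  have := hstep (M + k)
  have := hM (M + k) (Nat.le_add_right _ _)
  rw [Real.dist_eq, Nat.add_assoc]
  change d (N + (M + k)) < ε
  linarith

/-- The steady-state prediction variance: the root in `(0, 1)` of the algebraic Riccati
equation. -/
theorem exists_riccati_root {η σ : ℝ} (hη₀ : 0 < η) (hη₁ : η < 1) (hσ : 0 < σ) :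
    ∃ p ∈ Ioo (0 : ℝ) 1, (1 - p) * (p + σ ^ 2) = η ^ 2 * (p + (1 - p) * σ ^ 2) := by
  have hη : 0 < 1 - η ^ 2 := by nlinarith
  have hcont : ContinuousOn
      (fun p : ℝ => η ^ 2 * (p + (1 - p) * σ ^ 2) - (1 - p) * (p + σ ^ 2)) (Icc 0 1) := by
    fun_prop
  have h0 : (0 : ℝ) ∈ Ioo
      ((fun p : ℝ => η ^ 2 * (p + (1 - p) * σ ^ 2) - (1 - p) * (p + σ ^ 2)) 0)
      ((fun p : ℝ => η ^ 2 * (p + (1 - p) * σ ^ 2) - (1 - p) * (p + σ ^ 2)) 1) := by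
    have : 0 < (1 - η ^ 2) * σ ^ 2 := by positivity
    constructor
    · simp only; linarith
    · simp; positivity
  obtain ⟨p, hp, hp0⟩ := intermediate_value_Ioo zero_le_one hcont h0
  exact ⟨p, hp, by simp only at hp0; linarith⟩

/-- The Riccati recursion is a contraction by the factor `η²`. -/
theorem tendsto_kalmanVar {η σ p : ℝ} (hη : η ^ 2 < 1) (hσ : 0 < σ) (hp : 0 < p)
    (hR : (1 - p) * (p + σ ^ 2) = η ^ 2 * (p + (1 - p) * σ ^ 2)) :
    Tendsto (kalmanVar η σ) atTop (𝓝 p) := by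
  have hη0 : 0 ≤ η ^ 2 := sq_nonneg η
  have hbound : ∀ t, |kalmanVar η σ t - p| ≤ (η ^ 2) ^ t * |1 - p| := by
    intro t
    induction t with
    | zero => simp [kalmanVar]
    | succ t ih =>
      have hP := kalmanVar_pos (σ := σ) hη t
      set P := kalmanVar η σ t with hPdef
      have hfix : p = η ^ 2 * (p * σ ^ 2 / (p + σ ^ 2)) + (1 - η ^ 2) := by
        field_simp; linear_combination -hR
      have he : kalmanVar η σ (t + 1) - p
          = η ^ 2 * (P - p) * (σ ^ 2 / (P + σ ^ 2) * (σ ^ 2 / (p + σ ^ 2))) := by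
        conv_lhs => rw [hfix]
        rw [kalmanVar, ← hPdef]
        field_simp; ring
      have hc : σ ^ 2 / (P + σ ^ 2) * (σ ^ 2 / (p + σ ^ 2)) ≤ 1 :=
        mul_le_one₀ ((div_le_one (by positivity)).2 (by linarith)) (by positivity)
          ((div_le_one (by positivity)).2 (by linarith))
      rw [he, abs_mul, abs_mul, abs_of_nonneg hη0,
        abs_of_nonneg (a := σ ^ 2 / (P + σ ^ 2) * (σ ^ 2 / (p + σ ^ 2))) (by positivity)]
      calc η ^ 2 * |P - p| * (σ ^ 2 / (P + σ ^ 2) * (σ ^ 2 / (p + σ ^ 2)))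
          ≤ η ^ 2 * |P - p| * 1 := by gcongr
        _ ≤ η ^ 2 * ((η ^ 2) ^ t * |1 - p|) := by rw [mul_one]; gcongr
        _ = (η ^ 2) ^ (t + 1) * |1 - p| := by ring
  have hgeo : Tendsto (fun t => (η ^ 2) ^ t * |1 - p|) atTop (𝓝 0) := by
    simpa using (tendsto_pow_atTop_nhds_zero_of_lt_one hη0 hη).mul_const |1 - p|
  rw [tendsto_iff_norm_sub_tendsto_zero]
  exact squeeze_zero (fun _ => norm_nonneg _) hbound hgeo

/-- The steady-state covariance of `θ_t` and `U_t`. -/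
noncomputable def steadyCov (η α : ℝ) : ℝ := η * α / (1 - η * (1 - α))

/-- The steady-state variance of `U_t` without quantization noise. -/
noncomputable def steadyVar (η σ α : ℝ) : ℝ :=
  (α ^ 2 * (1 + σ ^ 2) + 2 * α * (1 - α) * steadyCov η α) / (1 - (1 - α) ^ 2)

section Steady

variable {η σ α δ : ℝ}

theorem one_sub_sq_pos (hα : α ∈ Ioo (0 : ℝ) 1) : 0 < 1 - (1 - α) ^ 2 := by
  nlinarith [hα.1, hα.2]

theorem one_sub_mul_pos (hη₀ : 0 < η) (hη₁ : η < 1) (hα : α ∈ Ioo (0 : ℝ) 1) :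
    0 < 1 - η * (1 - α) := by
  nlinarith [hα.1, hα.2]

theorem steadyCov_pos (hη₀ : 0 < η) (hη₁ : η < 1) (hα : α ∈ Ioo (0 : ℝ) 1) :
    0 < steadyCov η α :=
  div_pos (mul_pos hη₀ hα.1) (one_sub_mul_pos hη₀ hη₁ hα)

theorem steadyVar_pos (hη₀ : 0 < η) (hη₁ : η < 1) (hα : α ∈ Ioo (0 : ℝ) 1) :
    0 < steadyVar η σ α := by
  have h1 := steadyCov_pos hη₀ hη₁ hα
  have h2 := one_sub_sq_pos hα
  have h3 := hα.1
  have h4 := sub_pos.2 hα.2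
  rw [steadyVar]; positivity

theorem tendsto_crossCov (hη₀ : 0 < η) (hη₁ : η < 1) (hα : α ∈ Ioo (0 : ℝ) 1) (c : ℝ) :
    Tendsto (crossCov η α c) atTop (𝓝 (steadyCov η α)) :=
  tendsto_of_affine_recursion (mul_nonneg hη₀.le (sub_nonneg.2 hα.2.le))
    (by linarith [one_sub_mul_pos hη₀ hη₁ hα]) (fun t => by rw [crossCov]; ring)
    tendsto_const_nhds

theorem tendsto_stateVar (hη₀ : 0 < η) (hη₁ : η < 1) (hα : α ∈ Ioo (0 : ℝ) 1) :
    Tendsto (stateVar η σ α δ 0 1 1) atTop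
      (𝓝 (steadyVar η σ α + δ ^ 2 / (1 - (1 - α) ^ 2))) := by
  rw [steadyVar, ← add_div]
  refine tendsto_of_affine_recursion (sq_nonneg _) (by linarith [one_sub_sq_pos hα])
    (y := fun t => α ^ 2 * (1 + σ ^ 2) + 2 * α * (1 - α) * crossCov η α 0 t + δ ^ 2)
    (fun t => by rw [stateVar]; ring) ?_
  exact (((tendsto_crossCov hη₀ hη₁ hα 0).const_mul _).const_add _).add_const _

theorem tendsto_residVar (hα : α ∈ Ioo (0 : ℝ) 1) :
    Tendsto (residVar α δ) atTop (𝓝 (δ ^ 2 / (1 - (1 - α) ^ 2))) :=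
  tendsto_of_affine_recursion (sq_nonneg _) (by linarith [one_sub_sq_pos hα])
    (fun t => by rw [residVar]) tendsto_const_nhds

variable {μ : Measure Ω} [IsProbabilityMeasure μ] {ξ : Source → Ω → ℝ}

theorem tendsto_informationContent (h : IsDriving η σ μ ξ) (hη₀ : 0 < η) (hη₁ : η < 1)
    (hα : α ∈ Ioo (0 : ℝ) 1) (hδ : 0 < δ) :
    Tendsto (informationContent η μ ξ α δ) atTop (𝓝 (ENNReal.ofReal
      (Real.log (1 + steadyVar η σ α * (1 - (1 - α) ^ 2) / δ ^ 2) / 2))) := by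
  have hη : η ^ 2 < 1 := by nlinarith
  rw [funext (informationContent_eq h hη₀.le hη hα)]
  have h1 := one_sub_sq_pos hα
  have h2 := steadyVar_pos (σ := σ) hη₀ hη₁ hα
  have he : 1 + steadyVar η σ α * (1 - (1 - α) ^ 2) / δ ^ 2
      = (steadyVar η σ α + δ ^ 2 / (1 - (1 - α) ^ 2)) / (δ ^ 2 / (1 - (1 - α) ^ 2)) := by
    field_simp; ring
  rw [he]
  refine ENNReal.tendsto_ofReal (Tendsto.div_const (Tendsto.log ?_ (by positivity)) _)
  exact (tendsto_stateVar hη₀ hη₁ hα).div (tendsto_residVar hα) (by positivity)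

/-- Without quantization noise, `Var(U_t | H_t)` tends to zero and the content diverges. -/
theorem tendsto_informationContent_zero (h : IsDriving η σ μ ξ) (hη₀ : 0 < η) (hη₁ : η < 1)
    (hα : α ∈ Ioo (0 : ℝ) 1) :
    Tendsto (informationContent η μ ξ α 0) atTop (𝓝 ⊤) := by
  have hη : η ^ 2 < 1 := by nlinarith
  rw [funext (informationContent_eq h hη₀.le hη hα)]
  refine ENNReal.tendsto_ofReal_atTop.comp ?_
  refine Tendsto.atTop_div_const two_pos (Real.tendsto_log_atTop.comp ?_)
  have hv := tendsto_stateVar (σ := σ) (δ := 0) hη₀ hη₁ hα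
  have hq := tendsto_residVar (δ := 0) hα
  simp only [ne_eq, OfNat.ofNat_ne_zero, not_false_eq_true, zero_pow, zero_div, add_zero] at hv hq
  have hq' : Tendsto (residVar α 0) atTop (𝓝[>] 0) :=
    tendsto_nhdsWithin_iff.2 ⟨hq, Eventually.of_forall fun t => residVar_pos hα.2 t⟩
  exact hv.pos_mul_atTop (steadyVar_pos hη₀ hη₁ hα) (tendsto_inv_nhdsGT_zero.comp hq')

theorem tendsto_informationalError (h : IsDriving η σ μ ξ) (hη₀ : 0 < η) (hη₁ : η < 1)
    (hσ : 0 < σ) {p : ℝ} (hp : 0 < p)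
    (hR : (1 - p) * (p + σ ^ 2) = η ^ 2 * (p + (1 - p) * σ ^ 2)) (hα : α ∈ Ioo (0 : ℝ) 1) :
    Tendsto (informationalError η μ ξ α δ) atTop (𝓝 (ENNReal.ofReal
      (Real.log ((1 + σ ^ 2 - steadyCov η α ^ 2 / (steadyVar η σ α + δ ^ 2 / (1 - (1 - α) ^ 2)))
        / (p + σ ^ 2)) / 2))) := by
  have hη : η ^ 2 < 1 := by nlinarith
  have h1 := one_sub_sq_pos hα
  have h2 := steadyVar_pos (σ := σ) hη₀ hη₁ hα
  have hv : steadyVar η σ α + δ ^ 2 / (1 - (1 - α) ^ 2) ≠ 0 := by positivity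
  have hps : 0 < p + σ ^ 2 := by positivity
  have hnum : Tendsto
      (fun t => 1 + σ ^ 2 - crossCov η α 0 t ^ 2 / stateVar η σ α δ 0 1 1 t) atTop
      (𝓝 (1 + σ ^ 2 - steadyCov η α ^ 2 / (steadyVar η σ α + δ ^ 2 / (1 - (1 - α) ^ 2)))) :=
    (((tendsto_crossCov hη₀ hη₁ hα 0).pow 2).div (tendsto_stateVar hη₀ hη₁ hα) hv).const_sub _
  have hden : Tendsto (fun t => kalmanVar η σ t + σ ^ 2) atTop (𝓝 (p + σ ^ 2)) :=
    (tendsto_kalmanVar hη hσ hp hR).add_const _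
  have hle := le_of_tendsto_of_tendsto' hden hnum fun t =>
    (informationalError_eq h hη₀.le hη hσ hα t).1
  rw [funext fun t => (informationalError_eq (δ := δ) h hη₀.le hη hσ hα t).2]
  refine ENNReal.tendsto_ofReal (Tendsto.div_const (Tendsto.log ?_ ?_) _)
  · exact hnum.div hden hps.ne'
  · exact (div_pos (hps.trans_le hle) hps).ne'

/-! ### The optimal stepsize -/

/-- The steady-state value of `Cov(θ, U)² / Var U` for the noiseless agent falls short of its upper
bound `1 - p = Var E[θ_t | H_t]` by a square that vanishes exactly when the forgetting
factor `1 - α` is that of the steady-state Kalman filter. -/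
theorem one_sub_sub_steadyCov_sq_div {p : ℝ} (hη₀ : 0 < η) (hη₁ : η < 1) (hp : 0 < p)
    (hR : (1 - p) * (p + σ ^ 2) = η ^ 2 * (p + (1 - p) * σ ^ 2)) (hα : α ∈ Ioo (0 : ℝ) 1) :
    1 - p - steadyCov η α ^ 2 / steadyVar η σ α
      = η ^ 2 * (p + (1 - p) * σ ^ 2) * (1 - α - η * σ ^ 2 / (p + σ ^ 2)) ^ 2
        / ((1 - η * (1 - α)) * (1 + η * (1 - α) + σ ^ 2 * (1 - η * (1 - α)))) := by
  have h1 := one_sub_sq_pos hα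
  have h2 := steadyVar_pos (σ := σ) hη₀ hη₁ hα
  have h3 := one_sub_mul_pos hη₀ hη₁ hα
  have h4 := hα.1
  have h5 : 0 < 1 + η * (1 - α) + σ ^ 2 * (1 - η * (1 - α)) := by
    have := mul_nonneg hη₀.le (sub_nonneg.2 hα.2.le)
    positivity
  have hps : 0 < p + σ ^ 2 := by positivity
  set b := η * σ ^ 2 / (p + σ ^ 2) with hb
  have hb' : b * (p + σ ^ 2) = η * σ ^ 2 := by rw [hb]; field_simp
  set β := 1 - α with hβ
  have hαβ : α = 1 - β := by rw [hβ]; ring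
  have hratio : steadyCov η α ^ 2 / steadyVar η σ α
      = η ^ 2 * (1 - β ^ 2) / ((1 - η * β) * (1 + η * β + σ ^ 2 * (1 - η * β))) := by
    rw [div_eq_div_iff h2.ne' (mul_pos h3 h5).ne', steadyVar, steadyCov, ← hβ]
    field_simp
    ring
  -- `e1` and `e2` match the linear and the constant coefficients of two quadratics in `β`.
  have e1 : (1 - p) * σ ^ 2 = η * (p + (1 - p) * σ ^ 2) * b :=
    mul_right_cancel₀ hps.ne' (by
      linear_combination σ ^ 2 * hR - η * (p + (1 - p) * σ ^ 2) * hb')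
  have e2 : (1 - p) * (1 + σ ^ 2) - η ^ 2 = η * b * ((1 - p) * σ ^ 2) :=
    mul_right_cancel₀ hps.ne' (by
      linear_combination (1 + σ ^ 2) * hR - η * ((1 - p) * σ ^ 2) * hb')
  rw [hratio, sub_div' (mul_pos h3 h5).ne']
  congr 1
  linear_combination e2 + (η * b - 2 * η * β) * e1

/-- The optimal stepsize, in terms of the steady-state prediction variance `p`. -/
noncomputable def optStep (η σ p : ℝ) : ℝ := 1 - η * σ ^ 2 / (p + σ ^ 2)

theorem optStep_mem {p : ℝ} (hη₀ : 0 < η) (hη₁ : η < 1) (hσ : 0 < σ) (hp : 0 < p) :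
    optStep η σ p ∈ Ioo (0 : ℝ) 1 := by
  have h1 : η * σ ^ 2 / (p + σ ^ 2) < 1 := by
    rw [div_lt_one (by positivity)]
    nlinarith [sq_nonneg σ]
  have h2 : 0 < η * σ ^ 2 / (p + σ ^ 2) := by positivity
  exact ⟨by rw [optStep]; linarith, by rw [optStep]; linarith⟩

theorem steadyCov_sq_div_optStep {p : ℝ} (hη₀ : 0 < η) (hη₁ : η < 1) (hσ : 0 < σ) (hp : 0 < p)
    (hR : (1 - p) * (p + σ ^ 2) = η ^ 2 * (p + (1 - p) * σ ^ 2)) :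
    steadyCov η (optStep η σ p) ^ 2 / steadyVar η σ (optStep η σ p) = 1 - p := by
  have h := one_sub_sub_steadyCov_sq_div hη₀ hη₁ hp hR (optStep_mem hη₀ hη₁ hσ hp)
  have h0 : 1 - optStep η σ p - η * σ ^ 2 / (p + σ ^ 2) = 0 := by rw [optStep]; ring
  rw [h0] at h
  simp only [ne_eq, OfNat.ofNat_ne_zero, not_false_eq_true, zero_pow, mul_zero, zero_div] at h
  linarith

theorem steadyCov_sq_div_lt {p : ℝ} (hη₀ : 0 < η) (hη₁ : η < 1) (hp : p ∈ Ioo (0 : ℝ) 1)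
    (hR : (1 - p) * (p + σ ^ 2) = η ^ 2 * (p + (1 - p) * σ ^ 2)) (hα : α ∈ Ioo (0 : ℝ) 1)
    (hne : α ≠ optStep η σ p) : steadyCov η α ^ 2 / steadyVar η σ α < 1 - p := by
  have h := one_sub_sub_steadyCov_sq_div hη₀ hη₁ hp.1 hR hα
  have h0 : 1 - α - η * σ ^ 2 / (p + σ ^ 2) ≠ 0 := fun h0 => hne (by rw [optStep]; linarith)
  have h1 := hp.1
  have h2 := sub_pos.2 hp.2
  have h3 := one_sub_mul_pos hη₀ hη₁ hα
  have h4 : 0 < 1 + η * (1 - α) + σ ^ 2 * (1 - η * (1 - α)) := by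
    have := mul_nonneg hη₀.le (sub_nonneg.2 hα.2.le)
    positivity
  have : 0 < η ^ 2 * (p + (1 - p) * σ ^ 2) * (1 - α - η * σ ^ 2 / (p + σ ^ 2)) ^ 2
        / ((1 - η * (1 - α)) * (1 + η * (1 - α) + σ ^ 2 * (1 - η * (1 - α)))) := by
    positivity
  linarith

/-- The minimizer of the error when `Cov(θ, U)² / Var U` is scaled by a factor `l` that does not
depend on the stepsize. A capacity constraint has this effect, with `l < 1`, and `l = 1` is the case
without quantization noise. -/
theorem isMinOn_error_iff {p l : ℝ} (hη₀ : 0 < η) (hη₁ : η < 1) (hσ : 0 < σ)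
    (hp : p ∈ Ioo (0 : ℝ) 1)
    (hR : (1 - p) * (p + σ ^ 2) = η ^ 2 * (p + (1 - p) * σ ^ 2)) (hl₀ : 0 < l) (hl₁ : l ≤ 1)
    {E : ℝ → ℝ≥0∞} (hE : ∀ a ∈ Ioo (0 : ℝ) 1, E a = ENNReal.ofReal
      (Real.log ((1 + σ ^ 2 - l * (steadyCov η a ^ 2 / steadyVar η σ a)) / (p + σ ^ 2)) / 2))
    (hα : α ∈ Ioo (0 : ℝ) 1) : IsMinOn E (Ioo 0 1) α ↔ α = optStep η σ p := by
  have hopt := optStep_mem hη₀ hη₁ hσ hp.1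
  have hps : 0 < p + σ ^ 2 := by have := hp.1; positivity
  have hlt : ∀ a ∈ Ioo (0 : ℝ) 1, a ≠ optStep η σ p → E (optStep η σ p) < E a := by
    intro a ha hne
    have h1 := steadyCov_sq_div_lt hη₀ hη₁ hp hR ha hne
    have h2 : l * (steadyCov η a ^ 2 / steadyVar η σ a) < l * (1 - p) := by gcongr
    have h3 : l * (1 - p) ≤ 1 - p := mul_le_of_le_one_left (sub_nonneg.2 hp.2.le) hl₁
    have h4 : 1 ≤ (1 + σ ^ 2 - l * (1 - p)) / (p + σ ^ 2) := by
      rw [le_div_iff₀ hps]; linarith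
    have h5 : (1 + σ ^ 2 - l * (1 - p)) / (p + σ ^ 2)
        < (1 + σ ^ 2 - l * (steadyCov η a ^ 2 / steadyVar η σ a)) / (p + σ ^ 2) := by
      gcongr
    have h6 := Real.log_lt_log (one_pos.trans_le h4) h5
    have h7 := Real.log_nonneg h4
    rw [hE a ha, hE _ hopt, steadyCov_sq_div_optStep hη₀ hη₁ hσ hp.1 hR,
      ENNReal.ofReal_lt_ofReal_iff (by linarith)]
    linarith
  constructor
  · intro hmin
    by_contra hne
    exact (hlt α hα hne).not_ge (hmin hopt)
  · rintro rfl a ha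
    rcases eq_or_ne a (optStep η σ p) with rfl | hne
    · exact le_refl (E _)
    · exact (hlt a ha hne).le

/-- The equation `log (1 + A / δ²) / 2 = C` for the content, solved for the intensity `δ` of the
quantization noise. -/
theorem ofReal_log_eq_iff {A C : ℝ} (hA : 0 < A) (hC : 0 < C) (hδ : 0 < δ) :
    ENNReal.ofReal (Real.log (1 + A / δ ^ 2) / 2) = ENNReal.ofReal C
      ↔ δ ^ 2 = A / (Real.exp (2 * C) - 1) := by
  have h1 : 1 < Real.exp (2 * C) := Real.one_lt_exp_iff.2 (by positivity)
  have h2 : 0 < A / δ ^ 2 := by positivity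
  have h3 : 0 < Real.exp (2 * C) - 1 := sub_pos.2 h1
  rw [ENNReal.ofReal_eq_ofReal_iff (div_nonneg (Real.log_nonneg (by linarith)) two_pos.le) hC.le,
    div_eq_iff two_ne_zero, ← Real.log_exp (C * 2),
    Real.log_injOn_pos.eq_iff (show (0 : ℝ) < _ by positivity) (Real.exp_pos _), mul_comm C,
    eq_div_iff h3.ne', ← eq_sub_iff_add_eq', div_eq_iff (by positivity), mul_comm (δ ^ 2)]
  exact eq_comm

end Steady

end

section

variable {Ω : Type*} [MeasurableSpace Ω]

/-! ### Steady-state initializations -/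

/-- The sources of the noiseless agent that is started at `S₀`. The quantization noise, which plays
no role, is set to zero so that nothing is required of its joint law with `S₀`. -/
def startAt {Ω : Type*} (ξ : Source → Ω → ℝ) (S₀ : Ω → ℝ) : Source → Ω → ℝ
  | .theta => ξ .theta
  | .agent => S₀
  | .process t => ξ (.process t)
  | .observation t => ξ (.observation t)
  | .quantization _ => 0

theorem latent_startAt {Ω : Type*} (η : ℝ) (ξ : Source → Ω → ℝ) (S₀ : Ω → ℝ) (t : ℕ) :
    latent η (startAt ξ S₀) t = latent η ξ t := by
  induction t with
  | zero => rfl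
  | succ t ih => simp only [latent, ih]; rfl

theorem label_startAt {Ω : Type*} (η : ℝ) (ξ : Source → Ω → ℝ) (S₀ : Ω → ℝ) (t : ℕ) :
    label η (startAt ξ S₀) t = label η ξ t := by
  cases t with
  | zero => rfl
  | succ t => simp only [label, latent_startAt]; rfl

theorem state_startAt {Ω : Type*} (η : ℝ) (ξ : Source → Ω → ℝ) (S₀ : Ω → ℝ) (α : ℝ) (t : ℕ) :
    state η (startAt ξ S₀) α 0 t = stateFrom η ξ S₀ α 0 t := by
  induction t with
  | zero => rfl
  | succ t ih =>
    simp only [state] at ih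
    ext ω
    simp [state, stateFrom, ih, label_startAt]

theorem history_startAt {Ω : Type*} (η : ℝ) (ξ : Source → Ω → ℝ) (S₀ : Ω → ℝ) (t : ℕ) :
    history η (startAt ξ S₀) t = history η ξ t := by
  ext ω i
  simp only [history, label_startAt]

section StartAt

variable {η σ : ℝ} {μ : Measure Ω} {ξ : Source → Ω → ℝ} {S₀ : Ω → ℝ}

theorem isGaussianProcess_startAt (hξ : IsGaussianProcess ξ μ)
    (hg : HasGaussianLaw (fun ω => (ξ .theta ω, S₀ ω)) μ)
    (hind : IndepFun (fun ω => (ξ .theta ω, S₀ ω))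
      (fun ω (t : ℕ) => (ξ (.process t) ω, ξ (.observation t) ω)) μ) :
    IsGaussianProcess (startAt ξ S₀) μ := by
  constructor
  intro I
  -- `startAt ξ S₀ s = a s * θ₀ + b s * S₀ + m s * ξ s` with indicator coefficients.
  let a : Source → ℝ := fun s => match s with | .theta => 1 | _ => 0
  let b : Source → ℝ := fun s => match s with | .agent => 1 | _ => 0
  let m : Source → ℝ := fun s => match s with | .process _ => 1 | .observation _ => 1 | _ => 0
  have hQ : HasGaussianLaw (fun ω (i : I) => m i * ξ i ω) μ :=
    (hξ.hasGaussianLaw I).map (ContinuousLinearMap.pi fun i : I =>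
      m i • (ContinuousLinearMap.proj i : (I → ℝ) →L[ℝ] ℝ))
  have hPQ : IndepFun (fun ω => (ξ .theta ω, S₀ ω)) (fun ω (i : I) => m i * ξ i ω) μ := by
    let φ : (ℕ → ℝ × ℝ) → I → ℝ := fun z i => match i.1 with
      | .process t => (z t).1
      | .observation t => (z t).2
      | _ => 0
    have hφ : Measurable φ := by
      refine measurable_pi_lambda _ fun ⟨i, hi⟩ => ?_
      cases i <;> simp only [φ] <;> fun_prop
    have he : (fun ω (i : I) => m i * ξ i ω)
        = φ ∘ fun ω (t : ℕ) => (ξ (.process t) ω, ξ (.observation t) ω) := by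
      ext ω ⟨i, hi⟩
      cases i <;> simp [m, φ]
    rw [he]
    exact hind.comp measurable_id hφ
  have := (hPQ.hasGaussianLaw hg hQ).map (ContinuousLinearMap.pi fun i : I =>
    a i • (ContinuousLinearMap.fst ℝ ℝ ℝ).comp (ContinuousLinearMap.fst ℝ (ℝ × ℝ) (I → ℝ))
    + b i • (ContinuousLinearMap.snd ℝ ℝ ℝ).comp (ContinuousLinearMap.fst ℝ (ℝ × ℝ) (I → ℝ))
    + (ContinuousLinearMap.proj i).comp (ContinuousLinearMap.snd ℝ (ℝ × ℝ) (I → ℝ)))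
  convert! this using 1
  ext ω ⟨i, hi⟩
  cases i <;> simp [a, b, m, startAt]

theorem IsDriving.isGaussianDriving_startAt [IsProbabilityMeasure μ] (h : IsDriving η σ μ ξ)
    (hη : η ^ 2 < 1)
    (hm : Measurable S₀) (hg : HasGaussianLaw (fun ω => (ξ .theta ω, S₀ ω)) μ)
    (hind : IndepFun (fun ω => (ξ .theta ω, S₀ ω))
      (fun ω (t : ℕ) => (ξ (.process t) ω, ξ (.observation t) ω)) μ) :
    IsGaussianDriving η σ cov[ξ .theta, S₀; μ] cov[S₀, S₀; μ] 0 μ (startAt ξ S₀) where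
  measurable s := by
    cases s <;> simp only [startAt]
    all_goals first
      | exact hm
      | exact h.measurable _
      | exact measurable_zero
  gaussian := isGaussianProcess_startAt (h.isGaussianDriving hη).gaussian hg hind
  cov s t := by
    have hd := h.isGaussianDriving hη
    have hS : MemLp S₀ 2 μ := hg.snd.memLp_two
    have hL : ∀ s, MemLp (ξ s) 2 μ := fun s => (hd.gaussian.hasGaussianLaw_eval s).memLp_two
    have hp : ∀ t, cov[S₀, ξ (.process t); μ] = 0 := fun t =>
      (hind.comp measurable_snd
        (measurable_fst.comp (measurable_pi_apply t))).covariance_eq_zero hS (hL _)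
    have ho : ∀ t, cov[S₀, ξ (.observation t); μ] = 0 := fun t =>
      (hind.comp measurable_snd
        (measurable_snd.comp (measurable_pi_apply t))).covariance_eq_zero hS (hL _)
    have hp' : ∀ t, cov[ξ (.process t), S₀; μ] = 0 := fun t => (covariance_comm _ _).trans (hp t)
    have ho' : ∀ t, cov[ξ (.observation t), S₀; μ] = 0 := fun t =>
      (covariance_comm _ _).trans (ho t)
    cases s <;> cases t <;>
      simp [startAt, sourceCov, hd.cov, hp, ho, hp', ho', covariance_comm S₀ (ξ .theta)]

end StartAt

/-! ### The Markov property -/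

section Markov

variable {η σ α : ℝ} {μ : Measure Ω} {ξ : Source → Ω → ℝ}

theorem steadyCov_fixed (hη₀ : 0 < η) (hη₁ : η < 1) (hα : α ∈ Ioo (0 : ℝ) 1) :
    steadyCov η α = η * ((1 - α) * steadyCov η α + α) := by
  have := one_sub_mul_pos hη₀ hη₁ hα
  rw [steadyCov]; field_simp; ring

theorem steadyVar_fixed (hα : α ∈ Ioo (0 : ℝ) 1) :
    steadyVar η σ α = (1 - α) ^ 2 * steadyVar η σ α + α ^ 2 * (1 + σ ^ 2)
      + 2 * α * (1 - α) * steadyCov η α := by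
  have h := one_sub_sq_pos hα
  have : steadyVar η σ α * (1 - (1 - α) ^ 2)
      = α ^ 2 * (1 + σ ^ 2) + 2 * α * (1 - α) * steadyCov η α := by
    rw [steadyVar, div_mul_cancel₀ _ h.ne']
  linarith

theorem crossCov_steady (hη₀ : 0 < η) (hη₁ : η < 1) (hα : α ∈ Ioo (0 : ℝ) 1) (t : ℕ) :
    crossCov η α (steadyCov η α) t = steadyCov η α := by
  induction t with
  | zero => rfl
  | succ t ih => rw [crossCov, ih, ← steadyCov_fixed hη₀ hη₁ hα]

theorem stateVar_steady (hη₀ : 0 < η) (hη₁ : η < 1) (hα : α ∈ Ioo (0 : ℝ) 1) (t : ℕ) :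
    stateVar η σ α 0 (steadyCov η α) (steadyVar η σ α) 0 t = steadyVar η σ α := by
  induction t with
  | zero => rfl
  | succ t ih =>
    rw [stateVar, ih, crossCov_steady hη₀ hη₁ hα]
    linarith [steadyVar_fixed (η := η) (σ := σ) hα]

/-- With the optimal stepsize `α`, the coefficient `κ = c / v` of the regression of `θ_t` on `U_t`
satisfies `η - κ α = 1 - α`. This makes the error `θ_t - κ U_t` autoregressive with factor `1 - α`,
as the error of the steady-state Kalman filter is. -/
theorem sub_mul_optStep {p : ℝ} (hη₀ : 0 < η) (hη₁ : η < 1) (hσ : 0 < σ) (hp : 0 < p)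
    (hR : (1 - p) * (p + σ ^ 2) = η ^ 2 * (p + (1 - p) * σ ^ 2)) :
    η - steadyCov η (optStep η σ p) / steadyVar η σ (optStep η σ p) * optStep η σ p
      = 1 - optStep η σ p := by
  have hα := optStep_mem (σ := σ) hη₀ hη₁ hσ hp
  have hβ : (1 - optStep η σ p) * (p + σ ^ 2) = η * σ ^ 2 := by
    rw [optStep]; field_simp; ring
  have hsq := steadyCov_sq_div_optStep hη₀ hη₁ hσ hp hR
  set α := optStep η σ p with hαdef
  have hc := steadyCov_pos hη₀ hη₁ hα
  have hv := steadyVar_pos (σ := σ) hη₀ hη₁ hα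
  have hfix := steadyCov_fixed hη₀ hη₁ hα
  set κ := steadyCov η α / steadyVar η σ α with hκ
  have hκc : κ * steadyCov η α = 1 - p := by rw [← hsq, hκ]; ring
  have hκα : η * (κ * α) = (1 - p) * (1 - η * (1 - α)) := by
    linear_combination κ * (-hfix) + (1 - η * (1 - α)) * hκc
  have hps : p + σ ^ 2 ≠ 0 := by positivity
  refine mul_left_cancel₀ (mul_ne_zero hη₀.ne' hps) ?_
  linear_combination (-(p + σ ^ 2)) * hκα + (-η * p) * hβ - hR

/-- In steady state, the optimal agent predicts the next label as well as the history does: the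
regression error of `Y_{t+1}` on `U_t` is uncorrelated with the whole history. -/
theorem covForm_steady_error {p : ℝ} (hη₀ : 0 < η) (hη₁ : η < 1) (hσ : 0 < σ) (hp : 0 < p)
    (hR : (1 - p) * (p + σ ^ 2) = η ^ 2 * (p + (1 - p) * σ ^ 2)) (hα : α = optStep η σ p)
    (t : ℕ) {x : Source →₀ ℝ} (hx : x = stateVec η α 0 t ∨ ∃ i < t, x = labelVec η (i + 1)) :
    covForm η σ (steadyCov η α) (steadyVar η σ α) 0 x
      (labelVec η (t + 1) - (steadyCov η α / steadyVar η σ α) • stateVec η α 0 t) = 0 := by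
  have hmem : α ∈ Ioo (0 : ℝ) 1 := hα ▸ optStep_mem hη₀ hη₁ hσ hp
  have hβ : (1 - α) * (p + σ ^ 2) = η * σ ^ 2 := by
    rw [hα, optStep]; field_simp; ring
  have hsq := steadyCov_sq_div_optStep hη₀ hη₁ hσ hp hR
  have hκα := sub_mul_optStep hη₀ hη₁ hσ hp hR
  rw [← hα] at hsq hκα
  have hv := steadyVar_pos (σ := σ) hη₀ hη₁ hmem
  set c := steadyCov η α with hc
  set v := steadyVar η σ α with hvdef
  set κ := c / v with hκ
  have hκc : κ * c = 1 - p := by rw [← hsq, hκ]; ring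
  have hxu : ∀ t, covForm η σ c v 0 (latentVec η t) (stateVec η α 0 t) = c := fun t =>
    (covForm_latentVec_stateVec η σ α 0 c v 0 t).trans (crossCov_steady hη₀ hη₁ hmem t)
  have huu : ∀ t, covForm η σ c v 0 (stateVec η α 0 t) (stateVec η α 0 t) = v := fun t =>
    (covForm_stateVec_self η σ α 0 c v 0 t).trans (stateVar_steady hη₀ hη₁ hmem t)
  have hxx : ∀ t, covForm η σ c v 0 (latentVec η t) (latentVec η t) = 1 :=
    covForm_latentVec_self η σ c v 0
  have hstate : ∀ t, covForm η σ c v 0 (stateVec η α 0 t)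
      (latentVec η t - κ • stateVec η α 0 t) = 0 := fun t => by
    rw [map_sub, map_smul, covForm_comm, hxu, huu, smul_eq_mul, hκ, div_mul_cancel₀ _ hv.ne',
      sub_self]
  have hlatent : ∀ t, covForm η σ c v 0 (latentVec η t)
      (latentVec η t - κ • stateVec η α 0 t) = p := fun t => by
    rw [map_sub, map_smul, hxu, hxx, smul_eq_mul, hκc, sub_sub_cancel]
  have hrec : ∀ t, latentVec η (t + 1) - κ • stateVec η α 0 (t + 1)
      = (1 - α) • (latentVec η t - κ • stateVec η α 0 t) + src (.process (t + 1))
        - (κ * α) • src (.observation (t + 1)) := fun t => by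
    simp only [latentVec, stateVec, labelVec, zero_smul, add_zero]
    rw [← hκα]
    module
  have hlabel : ∀ t, ∀ i < t, covForm η σ c v 0 (labelVec η (i + 1))
      (latentVec η t - κ • stateVec η α 0 t) = 0 := by
    intro t
    induction t with
    | zero => simp
    | succ t ih =>
      intro i hi
      rw [hrec, map_sub, map_add, map_smul, map_smul]
      rcases Nat.lt_succ_iff_lt_or_eq.1 hi with hi | rfl
      · have hl : labelVec η (i + 1) ∈ past t := past_mono hi (labelVec_mem_past η _)
        rw [ih i hi, covForm_past hl (s := .process (t + 1)) t.lt_succ_self,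
          covForm_past hl (s := .observation (t + 1)) t.lt_succ_self]
        simp
      · have hE : latentVec η i - κ • stateVec η α 0 i ∈ past i :=
          sub_mem (latentVec_mem_past η i) (Submodule.smul_mem _ _ (stateVec_mem_past η α 0 i))
        have h1 : covForm η σ c v 0 (src (.observation (i + 1)))
            (latentVec η i - κ • stateVec η α 0 i) = 0 :=
          (covForm_comm η σ c v 0 _ _).trans (covForm_past hE i.lt_succ_self)
        have h2 : covForm η σ c v 0 (latentVec η i) (src (.process (i + 1))) = 0 :=
          covForm_past (latentVec_mem_past η i) i.lt_succ_self
        have h3 : covForm η σ c v 0 (latentVec η i) (src (.observation (i + 1))) = 0 :=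
          covForm_past (latentVec_mem_past η i) i.lt_succ_self
        simp only [labelVec, map_add, LinearMap.add_apply, hlatent, h1, h2, h3, covForm_src,
          sourceCov, smul_eq_mul, if_true]
        linear_combination hβ + σ ^ 2 * hκα
  have hsplit : labelVec η (t + 1) - κ • stateVec η α 0 t
      = (latentVec η t - κ • stateVec η α 0 t) + src (.observation (t + 1)) := by
    rw [labelVec]; abel
  rw [hsplit, map_add]
  rcases hx with rfl | ⟨i, hi, rfl⟩
  · rw [hstate, covForm_past (stateVec_mem_past η α 0 t) (s := .observation (t + 1))
      t.lt_succ_self, add_zero]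
  · rw [hlabel t i hi, covForm_past (past_mono hi (labelVec_mem_past η _))
      (s := .observation (t + 1)) t.lt_succ_self, add_zero]

/-- The moments of a steady-state initialization are the steady-state moments: the covariance
recursions have no other fixed point. -/
theorem IsSteadyStart.moments {S₀ : Ω → ℝ} [IsProbabilityMeasure μ] (h : IsDriving η σ μ ξ)
    (hη₀ : 0 < η) (hη₁ : η < 1) (hα : α ∈ Ioo (0 : ℝ) 1) (hS : IsSteadyStart η μ ξ α S₀) :
    cov[ξ .theta, S₀; μ] = steadyCov η α ∧ cov[S₀, S₀; μ] = steadyVar η σ α := by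
  have hη : η ^ 2 < 1 := by nlinarith
  have hd := h.isGaussianDriving_startAt hη hS.measurable hS.gaussian hS.indep
  set c := cov[ξ .theta, S₀; μ] with hc
  set v := cov[S₀, S₀; μ] with hv
  have hstate : ∀ t, stateFrom η ξ S₀ α 0 t
      = Finsupp.linearCombination ℝ (startAt ξ S₀) (stateVec η α 0 t) := fun t => by
    rw [linearCombination_stateVec, state_startAt]
  have hlabel : ∀ t, label η ξ t
      = Finsupp.linearCombination ℝ (startAt ξ S₀) (labelVec η t) := fun t => by
    rw [linearCombination_labelVec, label_startAt]
  have hcov : ∀ t, cov[stateFrom η ξ S₀ α 0 t, label η ξ (t + 1); μ] = crossCov η α c t := by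
    intro t
    rw [hstate, hlabel, hd.covariance_linearCombination, labelVec, map_add,
      covForm_past (stateVec_mem_past η α 0 t) (s := .observation (t + 1)) t.lt_succ_self,
      add_zero, covForm_comm,
      covForm_latentVec_stateVec]
  have hvar : ∀ t, cov[stateFrom η ξ S₀ α 0 t, stateFrom η ξ S₀ α 0 t; μ]
      = stateVar η σ α 0 c v 0 t := by
    intro t
    rw [hstate, hd.covariance_linearCombination, covForm_stateVec_self]
  have hms : ∀ t, Measurable (stateFrom η ξ S₀ α 0 t) := fun t =>
    hstate t ▸ measurable_linearCombination hd.measurable _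
  have hml : ∀ t, Measurable (label η ξ t) := fun t =>
    hlabel t ▸ measurable_linearCombination hd.measurable _
  have hproj : Measurable fun z : ℕ → ℝ × ℝ => ((z 0).1, (z 1).2) := by fun_prop
  -- `Cov(U_{t+1}, Y_{t+2}) = Cov(θ_{t+1}, U_{t+1})` can be read off the observed process.
  have hpair := (hS.stationary.comp hproj).map_eq
  have e1 : crossCov η α c 2 = crossCov η α c 1 := by
    rw [← hcov, ← hcov]
    have hmap : ∀ X Y : Ω → ℝ, Measurable X → Measurable Y →
        cov[X, Y; μ] = cov[Prod.fst, Prod.snd; μ.map fun ω => (X ω, Y ω)] := fun X Y hX hY => by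
      rw [covariance_map (by fun_prop) (by fun_prop) (hX.prodMk hY).aemeasurable]
      rfl
    rw [hmap _ _ (hms _) (hml _), hmap _ _ (hms _) (hml _)]
    exact congrArg (fun ν => cov[Prod.fst, Prod.snd; ν]) hpair
  have hproj1 : Measurable fun z : ℕ → ℝ × ℝ => (z 0).1 := by fun_prop
  have e2 : stateVar η σ α 0 c v 0 2 = stateVar η σ α 0 c v 0 1 := by
    rw [← hvar, ← hvar, covariance_self (hms _).aemeasurable, covariance_self (hms _).aemeasurable]
    exact (hS.stationary.comp hproj1).variance_eq
  have hβ := sub_pos.2 hα.2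
  have h1 := one_sub_mul_pos hη₀ hη₁ hα
  have h2 := one_sub_sq_pos hα
  have hfc := steadyCov_fixed hη₀ hη₁ hα
  have hfv := steadyVar_fixed (η := η) (σ := σ) hα
  have hc' : c = steadyCov η α := by
    simp only [crossCov] at e1
    refine mul_left_cancel₀ (mul_pos (mul_pos hη₀ hβ) h1).ne' ?_
    linear_combination -e1 - η * (1 - α) * hfc
  refine ⟨hc', ?_⟩
  simp only [stateVar, crossCov, hc'] at e2
  rw [← hfc] at e2
  refine mul_left_cancel₀ (mul_pos (pow_pos hβ 2) h2).ne' ?_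
  linear_combination -e2 - (1 - α) ^ 2 * hfv

theorem IsSteadyStart.isMarkovTriple {S₀ : Ω → ℝ} [IsProbabilityMeasure μ]
    (h : IsDriving η σ μ ξ) {p : ℝ} (hη₀ : 0 < η) (hη₁ : η < 1) (hσ : 0 < σ) (hp : 0 < p)
    (hR : (1 - p) * (p + σ ^ 2) = η ^ 2 * (p + (1 - p) * σ ^ 2))
    (hS : IsSteadyStart η μ ξ (optStep η σ p) S₀) (t : ℕ) :
    IsMarkovTriple μ (label η ξ (t + 1)) (stateFrom η ξ S₀ (optStep η σ p) 0 t)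
      (history η ξ t) := by
  have hη : η ^ 2 < 1 := by nlinarith
  have hα := optStep_mem (σ := σ) hη₀ hη₁ hσ hp
  have hd := h.isGaussianDriving_startAt hη hS.measurable hS.gaussian hS.indep
  obtain ⟨hc, hv⟩ := hS.moments h hη₀ hη₁ hα
  rw [hc, hv] at hd
  rw [← state_startAt, ← label_startAt η ξ S₀, ← history_startAt η ξ S₀]
  set ξ' := startAt ξ S₀
  set α := optStep η σ p with hαdef
  set κ := steadyCov η α / steadyVar η σ α with hκ
  set e := labelVec η (t + 1) - κ • stateVec η α 0 t with he
  -- The mean of `S₀` is not needed; the regression is allowed an intercept `m` instead.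
  set m := ∫ ω, Finsupp.linearCombination ℝ ξ' e ω ∂μ with hm
  have herr : (fun ω => label η ξ' (t + 1) ω - (κ * state η ξ' α 0 t ω + m))
      = (fun y => y - m) ∘ Finsupp.linearCombination ℝ ξ' e := by
    ext ω
    rw [← linearCombination_stateVec, ← linearCombination_labelVec, he, map_sub, map_smul]
    simp; ring
  have hlaw : μ.map (fun ω => label η ξ' (t + 1) ω - (κ * state η ξ' α 0 t ω + m))
      = gaussianReal 0 (covForm η σ (steadyCov η α) (steadyVar η σ α) 0 e e).toNNReal := by
    rw [herr, ← Measure.map_map (by fun_prop) (measurable_linearCombination hd.measurable _),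
      hd.map_linearCombination, gaussianReal_map_sub_const, ← hm, sub_self]
  have hind : IndepFun (fun ω => (state η ξ' α 0 t ω, history η ξ' t ω))
      (fun ω => label η ξ' (t + 1) ω - (κ * state η ξ' α 0 t ω + m)) μ := by
    let x : Option (Fin t) → Source →₀ ℝ := fun o =>
      o.elim (stateVec η α 0 t) fun i => labelVec η (i + 1)
    have hx : ∀ o (_ : Unit), covForm η σ (steadyCov η α) (steadyVar η σ α) 0 (x o) e = 0 := by
      rintro (_ | i) _
      · exact covForm_steady_error hη₀ hη₁ hσ hp hR hαdef t (Or.inl rfl)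
      · exact covForm_steady_error hη₀ hη₁ hσ hp hR hαdef t (Or.inr ⟨i, i.2, rfl⟩)
    have hpair : (fun ω => (state η ξ' α 0 t ω, history η ξ' t ω))
        = (fun z : Option (Fin t) → ℝ => (z none, fun i : Fin t => z (some i)))
          ∘ fun ω o => Finsupp.linearCombination ℝ ξ' (x o) ω := by
      rw [← linearCombination_stateVec, history_eq]
      rfl
    rw [hpair, herr]
    exact (hd.indepFun_linearCombination x (fun _ : Unit => e) hx).comp
      (φ := fun z => (z none, fun i : Fin t => z (some i))) (ψ := fun z => z () - m)
      (by fun_prop) (by fun_prop)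
  exact isMarkovTriple_of_gaussian_regression (f := fun u => κ * u + m)
    (measurable_state hd.measurable η α 0 t) (measurable_history hd.measurable η t)
    (measurable_label hd.measurable η _) (by fun_prop) hind hlaw

end Markov

/-! ### Existence of a steady-state initialization -/

/-- The sources of the dynamics restarted at time `1`, in terms of the sources from time `0`. The
noises with index `0`, which the dynamics does not use, are left in place: shifting them would put
`V₁`, which is correlated with `θ₁`, among the fresh noises. -/
noncomputable def shiftVec (η α : ℝ) : Source → Source →₀ ℝ
  | .theta => latentVec η 1
  | .agent => stateVec η α 0 1
  | .process 0 => src (.process 0)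
  | .process (t + 1) => src (.process (t + 2))
  | .observation 0 => src (.observation 0)
  | .observation (t + 1) => src (.observation (t + 2))
  | .quantization _ => 0

section Existence

variable {η σ α : ℝ}

/-- In steady state, restarting at time `1` does not change the covariances of the sources. -/
theorem covForm_shiftVec (hη₀ : 0 < η) (hη₁ : η < 1) (hα : α ∈ Ioo (0 : ℝ) 1) (s t : Source) :
    covForm η σ (steadyCov η α) (steadyVar η σ α) 0 (shiftVec η α s) (shiftVec η α t)
      = sourceCov η σ (steadyCov η α) (steadyVar η σ α) 0 s t := by
  have h1 := covForm_latentVec_self η σ (steadyCov η α) (steadyVar η σ α) 0 1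
  have h2 := (covForm_latentVec_stateVec η σ α 0 (steadyCov η α) (steadyVar η σ α) 0 1).trans
    (crossCov_steady hη₀ hη₁ hα 1)
  have h3 := (covForm_comm _ _ _ _ _ _ _).trans h2
  have h4 := (covForm_stateVec_self η σ α 0 (steadyCov η α) (steadyVar η σ α) 0 1).trans
    (stateVar_steady hη₀ hη₁ hα 1)
  rcases s with _ | _ | (_ | s) | (_ | s) | _ <;> rcases t with _ | _ | (_ | t) | (_ | t) | _ <;>
    first
    | exact h1
    | exact h2
    | exact h3
    | exact h4
    | simp [shiftVec, latentVec, stateVec, labelVec, sourceCov]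

theorem latent_shift {Ω : Type*} (α : ℝ) (ξ : Source → Ω → ℝ) (t : ℕ) :
    latent η (fun s => Finsupp.linearCombination ℝ ξ (shiftVec η α s)) t = latent η ξ (t + 1) := by
  induction t with
  | zero => exact linearCombination_latentVec η ξ 1
  | succ t ih =>
    rw [latent, ih]
    ext ω
    simp [latent, shiftVec, linearCombination_src]

theorem label_shift {Ω : Type*} (α : ℝ) (ξ : Source → Ω → ℝ) (t : ℕ) :
    label η (fun s => Finsupp.linearCombination ℝ ξ (shiftVec η α s)) (t + 1)
      = label η ξ (t + 2) := by
  ext ω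
  rw [label, latent_shift]
  simp [label, shiftVec, linearCombination_src]

theorem state_shift {Ω : Type*} (ξ : Source → Ω → ℝ) (t : ℕ) :
    state η (fun s => Finsupp.linearCombination ℝ ξ (shiftVec η α s)) α 0 t
      = state η ξ α 0 (t + 1) := by
  induction t with
  | zero => exact linearCombination_stateVec η ξ α 0 1
  | succ t ih =>
    simp only [state] at ih ⊢
    ext ω
    rw [stateFrom, ih, label_shift]
    change _ = stateFrom η ξ (ξ .agent) α 0 (t + 1) ω + α * (label η ξ (t + 2) ω
      - stateFrom η ξ (ξ .agent) α 0 (t + 1) ω) + 0 * ξ (.quantization (t + 2)) ω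
    simp

/-- The trajectory of agent states and labels is a measurable function of the sources. -/
theorem exists_measurable_trajectory (η α : ℝ) :
    ∃ F : (Source → ℝ) → ℕ → ℝ × ℝ, Measurable F ∧
      ∀ {Ω : Type*} (ξ : Source → Ω → ℝ),
        (fun ω (t : ℕ) => (state η ξ α 0 (t + 1) ω, label η ξ (t + 1) ω))
          = F ∘ fun ω s => ξ s ω := by
  let π : Source → (Source → ℝ) → ℝ := fun s x => x s
  have hπ : ∀ s, Measurable (π s) := measurable_pi_apply
  refine ⟨fun x t => (state η π α 0 (t + 1) x, label η π (t + 1) x), ?_, fun {Ω} ξ => ?_⟩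
  · exact measurable_pi_lambda _ fun t =>
      (measurable_state hπ η α 0 _).prodMk (measurable_label hπ η _)
  · ext ω t <;> simp only [← linearCombination_stateVec, ← linearCombination_labelVec] <;>
      simp [Finsupp.linearCombination_apply, Finsupp.sum, π]

theorem exists_isSteadyStart {μ : Measure Ω} [IsProbabilityMeasure μ] {ξ : Source → Ω → ℝ}
    (h : IsDriving η σ μ ξ) (hη₀ : 0 < η) (hη₁ : η < 1) (hα : α ∈ Ioo (0 : ℝ) 1)
    (hle : steadyCov η α ^ 2 ≤ steadyVar η σ α) : ∃ S₀ : Ω → ℝ, IsSteadyStart η μ ξ α S₀ := by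
  have hη : η ^ 2 < 1 := by nlinarith
  have hg := h.isGaussianDriving hη
  set c := steadyCov η α with hc
  set v := steadyVar η σ α with hv
  -- `S₀ = c θ₀ + √(v - c²) U₀` has the steady-state moments.
  set y : Source →₀ ℝ := c • src .theta + √(v - c ^ 2) • src .agent with hy
  set S₀ : Ω → ℝ := Finsupp.linearCombination ℝ ξ y with hS₀
  have hθ : ξ .theta = Finsupp.linearCombination ℝ ξ (src .theta) :=
    (linearCombination_src ξ _).symm
  have hmeas : Measurable S₀ := measurable_linearCombination h.measurable _
  have hgauss : HasGaussianLaw (fun ω => (ξ .theta ω, S₀ ω)) μ := by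
    have := (hg.isGaussianProcess_linearCombination
      fun b : Bool => cond b (src .theta) y).hasGaussianLaw_prodMk (s := true) (t := false)
    simpa [linearCombination_src] using this
  have hind : IndepFun (fun ω => (ξ .theta ω, S₀ ω))
      (fun ω (t : ℕ) => (ξ (.process t) ω, ξ (.observation t) ω)) μ := by
    have := (hg.indepFun_linearCombination (fun b : Bool => cond b (src .theta) y)
      (fun q : ℕ × Bool => cond q.2 (src (.process q.1)) (src (.observation q.1))) (by
        rintro (_ | _) ⟨t, _ | _⟩ <;> simp [hy, sourceCov])).comp
      (φ := fun z => (z true, z false)) (ψ := fun z (t : ℕ) => (z (t, true), z (t, false)))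
      (by fun_prop) (by fun_prop)
    simpa [Function.comp_def, linearCombination_src] using this
  have hd := h.isGaussianDriving_startAt hη hmeas hgauss hind
  have hcθ : cov[ξ .theta, S₀; μ] = c := by
    rw [hθ, hS₀, hg.covariance_linearCombination]
    simp [hy, sourceCov]
  have hvS : cov[S₀, S₀; μ] = v := by
    rw [hS₀, hg.covariance_linearCombination]
    simp only [hy, map_add, map_smul, LinearMap.add_apply, LinearMap.smul_apply, covForm_src,
      sourceCov, smul_eq_mul]
    have := Real.mul_self_sqrt (sub_nonneg.2 hle)
    linarith
  rw [hcθ, hvS] at hd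
  have h0 : ∀ s, ∫ ω, startAt ξ S₀ s ω ∂μ = 0 := by
    intro s
    cases s with
    | agent => exact hg.integral_linearCombination h.integral_eq_zero y
    | quantization t => simp [startAt]
    | _ => exact h.integral_eq_zero _
  refine ⟨S₀, hmeas, hgauss, hind, ?_⟩
  have hlaw := map_eq_of_isGaussianProcess
    (hd.isGaussianProcess_linearCombination (shiftVec η α)) hd.gaussian
    (fun _ => measurable_linearCombination hd.measurable _) hd.measurable
    (fun _ => hd.integral_linearCombination h0 _) h0 fun s t => by
      rw [hd.covariance_linearCombination, covForm_shiftVec hη₀ hη₁ hα, hd.cov]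
  obtain ⟨F, hF, hFξ⟩ := exists_measurable_trajectory η α
  have e1 := hFξ (startAt ξ S₀)
  have e2 := hFξ fun s => Finsupp.linearCombination ℝ (startAt ξ S₀) (shiftVec η α s)
  simp only [state_shift, label_shift, state_startAt, label_startAt] at e1 e2
  rw [e1, e2]
  have hid : IdentDistrib
      (fun ω s => Finsupp.linearCombination ℝ (startAt ξ S₀) (shiftVec η α s) ω)
      (fun ω s => startAt ξ S₀ s ω) μ μ :=
    ⟨(measurable_pi_lambda _ fun _ =>
      measurable_linearCombination hd.measurable _).aemeasurable,
      (measurable_pi_lambda _ hd.measurable).aemeasurable, hlaw⟩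
  exact hid.comp hF

end Existence

end

end LMS

theorem mainTheorem6 (η σ : ℝ) (hη₀ : 0 < η) (hη₁ : η < 1) (hσ : 0 < σ) :
    ∃ αstar ∈ Ioo (0 : ℝ) 1,
      ∀ {Ω : Type*} [MeasurableSpace Ω] (μ : Measure Ω) [IsProbabilityMeasure μ]
        (ξ : Source → Ω → ℝ), IsDriving η σ μ ξ →
      -- the steady-state quantities are limits
      (∀ α ∈ Ioo (0 : ℝ) 1, ∀ δ : ℝ, 0 ≤ δ →
        Tendsto (informationContent η μ ξ α δ) atTop (𝓝 (steadyContent η μ ξ α δ)) ∧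
        Tendsto (informationalError η μ ξ α δ) atTop (𝓝 (steadyError η μ ξ α δ))) ∧
      -- capacity `C`: the noise can be tuned, and `αstar` is the optimal stepsize
      (∀ C : ℝ, 0 < C →
        (∀ α ∈ Ioo (0 : ℝ) 1,
          ∃! δ : ℝ, 0 < δ ∧ steadyContent η μ ξ α δ = ENNReal.ofReal C) ∧
        ∀ δ : ℝ → ℝ,
          (∀ α ∈ Ioo (0 : ℝ) 1,
            0 < δ α ∧ steadyContent η μ ξ α (δ α) = ENNReal.ofReal C) →
          ∀ α ∈ Ioo (0 : ℝ) 1,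
            IsMinOn (fun a => steadyError η μ ξ a (δ a)) (Ioo 0 1) α ↔ α = αstar) ∧
      -- no quantization noise: infinite capacity, and the optimal stepsize is the same
      (∀ α ∈ Ioo (0 : ℝ) 1, steadyContent η μ ξ α 0 = ⊤) ∧
      (∀ α ∈ Ioo (0 : ℝ) 1,
        IsMinOn (fun a => steadyError η μ ξ a 0) (Ioo 0 1) α ↔ α = αstar) ∧
      steadyError η μ ξ αstar 0 = 0 ∧
      -- the noiseless agent with stepsize `αstar`, in steady state, is Markov
      (∃ S₀ : Ω → ℝ, IsSteadyStart η μ ξ αstar S₀) ∧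
      ∀ S₀ : Ω → ℝ, IsSteadyStart η μ ξ αstar S₀ → ∀ t : ℕ,
        IsMarkovTriple μ (label η ξ (t + 1)) (stateFrom η ξ S₀ αstar 0 t) (history η ξ t) := by
  obtain ⟨p, hp, hR⟩ := exists_riccati_root hη₀ hη₁ hσ
  have hopt := optStep_mem hη₀ hη₁ hσ hp.1
  refine ⟨optStep η σ p, hopt, fun {Ω} _ μ _ ξ h => ?_⟩
  have hcontent : ∀ α ∈ Ioo (0 : ℝ) 1, ∀ δ : ℝ, 0 < δ → steadyContent η μ ξ α δ =
      ENNReal.ofReal (Real.log (1 + steadyVar η σ α * (1 - (1 - α) ^ 2) / δ ^ 2) / 2) :=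
    fun α hα δ hδ => (tendsto_informationContent h hη₀ hη₁ hα hδ).limsup_eq
  have hcontent0 : ∀ α ∈ Ioo (0 : ℝ) 1, steadyContent η μ ξ α 0 = ⊤ :=
    fun α hα => (tendsto_informationContent_zero h hη₀ hη₁ hα).limsup_eq
  have herror : ∀ α ∈ Ioo (0 : ℝ) 1, ∀ δ : ℝ, steadyError η μ ξ α δ = ENNReal.ofReal
      (Real.log ((1 + σ ^ 2 - steadyCov η α ^ 2 / (steadyVar η σ α + δ ^ 2 / (1 - (1 - α) ^ 2)))
        / (p + σ ^ 2)) / 2) :=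
    fun α hα δ => (tendsto_informationalError h hη₀ hη₁ hσ hp.1 hR hα).limsup_eq
  have herror0 : ∀ α ∈ Ioo (0 : ℝ) 1, steadyError η μ ξ α 0 = ENNReal.ofReal (Real.log
      ((1 + σ ^ 2 - 1 * (steadyCov η α ^ 2 / steadyVar η σ α)) / (p + σ ^ 2)) / 2) :=
    fun α hα => by rw [herror α hα]; simp
  refine ⟨fun α hα δ hδ => ⟨?_, ?_⟩, fun C hC => ⟨fun α hα => ?_, fun δ hδ α hα => ?_⟩,
    hcontent0, fun α hα => isMinOn_error_iff hη₀ hη₁ hσ hp hR one_pos le_rfl herror0 hα, ?_, ?_,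
    fun S₀ hS t => hS.isMarkovTriple h hη₀ hη₁ hσ hp.1 hR t⟩
  · rcases hδ.eq_or_lt with rfl | hδ
    · rw [hcontent0 α hα]
      exact tendsto_informationContent_zero h hη₀ hη₁ hα
    · rw [hcontent α hα δ hδ]
      exact tendsto_informationContent h hη₀ hη₁ hα hδ
  · rw [herror α hα]
    exact tendsto_informationalError h hη₀ hη₁ hσ hp.1 hR hα
  · have hA : 0 < steadyVar η σ α * (1 - (1 - α) ^ 2) :=
      mul_pos (steadyVar_pos hη₀ hη₁ hα) (one_sub_sq_pos hα)
    have hE : 0 < Real.exp (2 * C) - 1 := sub_pos.2 (Real.one_lt_exp_iff.2 (by positivity))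
    have hq : 0 < steadyVar η σ α * (1 - (1 - α) ^ 2) / (Real.exp (2 * C) - 1) := by positivity
    refine ⟨√(steadyVar η σ α * (1 - (1 - α) ^ 2) / (Real.exp (2 * C) - 1)),
      ⟨Real.sqrt_pos.2 hq, ?_⟩, ?_⟩
    · rw [hcontent α hα _ (Real.sqrt_pos.2 hq), ofReal_log_eq_iff hA hC (Real.sqrt_pos.2 hq),
        Real.sq_sqrt hq.le]
    · rintro d ⟨hd, hdC⟩
      rw [hcontent α hα d hd, ofReal_log_eq_iff hA hC hd] at hdC
      rw [← hdC, Real.sqrt_sq hd.le]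
  · -- The constraint fixes the fraction of `Var U` that is not due to the quantization noise.
    have h1 : 1 < Real.exp (2 * C) := Real.one_lt_exp_iff.2 (by positivity)
    refine isMinOn_error_iff (l := (Real.exp (2 * C) - 1) / Real.exp (2 * C)) hη₀ hη₁ hσ hp hR
      (div_pos (sub_pos.2 h1) (Real.exp_pos _)) ((div_le_one (Real.exp_pos _)).2 (by linarith))
      (fun a ha => ?_) hα
    have hv := steadyVar_pos (σ := σ) hη₀ hη₁ ha
    have hb := one_sub_sq_pos ha
    obtain ⟨hd, hdC⟩ := hδ a ha
    rw [hcontent a ha _ hd, ofReal_log_eq_iff (mul_pos hv hb) hC hd] at hdC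
    have h2 : Real.exp (2 * C) - 1 ≠ 0 := (sub_pos.2 h1).ne'
    have h3 := (Real.exp_pos (2 * C)).ne'
    have hvar : steadyVar η σ a + δ a ^ 2 / (1 - (1 - a) ^ 2)
        = steadyVar η σ a * (Real.exp (2 * C) / (Real.exp (2 * C) - 1)) := by
      rw [hdC]; field_simp; ring
    rw [herror a ha, hvar]
    congr 5
    field_simp
  · rw [herror0 _ hopt, one_mul, steadyCov_sq_div_optStep hη₀ hη₁ hσ hp.1 hR]
    have hps : p + σ ^ 2 ≠ 0 := by have := hp.1; positivity
    rw [show 1 + σ ^ 2 - (1 - p) = p + σ ^ 2 by ring, div_self hps]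
    simp
  · refine exists_isSteadyStart h hη₀ hη₁ hopt ?_
    have hsq := steadyCov_sq_div_optStep hη₀ hη₁ hσ hp.1 hR
    rw [div_eq_iff (steadyVar_pos hη₀ hη₁ hopt).ne'] at hsq
    rw [hsq]
    exact mul_le_of_le_one_left (steadyVar_pos hη₀ hη₁ hopt).le (by linarith [hp.1])
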